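/- For $n\in\{8,10\}$ let $\omega=e^{2\pi i/n}$, $M=\mathbb Z[\omega]\subset\mathbb C$ and $\mathcal A_n=\{0\}\cup\{\omega^j: j\in\mathbb Z\}$. For $\beta\in M$, $\beta>1$, let $$X^{\mathcal A_n}(\beta)=\Big\{\sum_{j=0}^{N}a_j\beta^j : N\in\mathbb N,\ a_j\in\mathcal A_n\Big\},$$ and for $\gamma\in\mathbb C$, $|\gamma|<1$, let $$K(\gamma,\mathcal A_n)=\Big\{\sum_{i=0}^{\infty}a_i\gamma^i : a_i\in\mathcal A_n\Big\}.$$ For a ring automorphism $\sigma$ of $M$ and a window $\Omega\subset\mathbb C$ (a bounded set with non-empty interior), the cut-and-project set with window $\Omega$ is $$\Sigma(\Omega)=\{z\in M : \sigma(z)\in\Omega\}.$$ Let $\delta=1+\sqrt2$ (with $n=8$) and $\tau=\tfrac{1+\sqrt5}2$ (with $n=10$). For each of $(n,\beta)=(8,\delta),(10,\tau),(10,\tau^2)$ there is an automorphism $\sigma$ of $M$ with $|\sigma(\beta)|<1$, and for every such $\sigma$ the sets $\Omega$ below are windows and the following hold. 1. For $(8,\delta)$: $X^{\mathcal A_8}(\delta)=\Sigma\big(\mathrm{int}\,K(\sigma(\delta),\mathcal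 A_8)\big)=\Sigma\big(K(\sigma(\delta),\mathcal A_8)\big)$. 2. For $(10,\tau)$: $\mathrm{int}\,K(\sigma(\tau),\mathcal A_{10})$ is the open regular decagon $D$ of radius $\tau^2$, i.e. the interior of the convex hull of the points $\tau^2\omega^k$, $k\in\mathbb Z$, and $X^{\mathcal A_{10}}(\tau)=\Sigma(D)$. 3. For $(10,\tau^2)$: $X^{\mathcal A_{10}}(\tau^2)=\Sigma\big(\mathrm{int}\,K(\sigma(\tau^2),\mathcal A_{10})\big)$. -/

import Mathlib

namespace PisotCyclotomic

noncomputable section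

/-- The primitive root of unity `ω = exp(2πi/n)`. -/
def rootOfUnity (n : ℕ) : ℂ := Complex.exp (2 * Real.pi * Complex.I / n)

/-- The alphabet `𝒜_n`: all `n`-th roots of unity together with `0`. -/
def alphabet (n : ℕ) : Set ℂ := Set.range (fun j : ℤ => rootOfUnity n ^ j) ∪ {0}

/-- The spectrum of `β` over the alphabet `B`: all finite sums `∑_{j=0}^N a_j β^j` with `a_j ∈ B`. -/
def digitSpectrum (B : Set ℂ) (β : ℂ) : Set ℂ :=
  {z | ∃ (N : ℕ) (a : ℕ → ℂ), (∀ j, a j ∈ B) ∧ z = ∑ j ∈ Finset.range (N + 1), a j * β ^ j}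

/-- The set `K(γ, B)` of all sums of convergent series `∑_{i ≥ 0} a_i γ^i` with `a_i ∈ B`. -/
def attractor (γ : ℂ) (B : Set ℂ) : Set ℂ :=
  {z | ∃ a : ℕ → ℂ, (∀ i, a i ∈ B) ∧ HasSum (fun i => a i * γ ^ i) z}

/-- The ring `M = ℤ[ω]` of cyclotomic integers, as a subring of `ℂ`. -/
abbrev cyclotomicIntegers (n : ℕ) : Subalgebra ℤ ℂ := Algebra.adjoin ℤ {rootOfUnity n}

/-- The set `Σ(Ω) = {z ∈ ℤ[ω] : σ(z) ∈ Ω}`, for an automorphism `σ` of `ℤ[ω]`. -/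
def cutProject {n : ℕ} (σ : cyclotomicIntegers n ≃+* cyclotomicIntegers n) (Ω : Set ℂ) : Set ℂ :=
  {z | ∃ x : cyclotomicIntegers n, (x : ℂ) = z ∧ (σ x : ℂ) ∈ Ω}

/-- Acceptance windows: bounded sets with non-empty interior. -/
def IsWindow (Ω : Set ℂ) : Prop := Bornology.IsBounded Ω ∧ (interior Ω).Nonempty

/-- The open regular `n`-gon of radius `r`: the interior of the convex hull of the points
`r ω^k`. -/
def openPolygon (n : ℕ) (r : ℝ) : Set ℂ :=
  interior (convexHull ℝ (Set.range fun k : ℤ => (r : ℂ) * rootOfUnity n ^ k))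

theorem two_cos_mem (n : ℕ) (hn : n ≠ 0) :
    ((2 * Real.cos (2 * Real.pi / n) : ℝ) : ℂ) ∈ cyclotomicIntegers n := by
  have h1 : rootOfUnity n ∈ cyclotomicIntegers n := Algebra.subset_adjoin rfl
  have hpow : rootOfUnity n ^ n = 1 := (Complex.isPrimitiveRoot_exp n hn).pow_eq_one
  have h2 : (rootOfUnity n)⁻¹ = rootOfUnity n ^ (n - 1) := by
    refine inv_eq_of_mul_eq_one_right ?_
    rw [mul_pow_sub_one hn, hpow]
  have h3 : ((2 * Real.cos (2 * Real.pi / n) : ℝ) : ℂ)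
      = rootOfUnity n + (rootOfUnity n)⁻¹ := by
    rw [rootOfUnity, ← Complex.exp_neg]
    push_cast
    rw [Complex.two_cos]
    congr 2 <;> ring
  rw [h3, h2]
  exact add_mem h1 (pow_mem h1 _)

/-- `δ = 1 + √2` lies in `ℤ[ω]` for `n = 8`. -/
theorem delta_mem : ((1 + √2 : ℝ) : ℂ) ∈ cyclotomicIntegers 8 := by
  have h := two_cos_mem 8 (by norm_num)
  have e : 2 * Real.cos (2 * Real.pi / (8 : ℕ)) = √2 := by
    rw [show 2 * Real.pi / (8 : ℕ) = Real.pi / 4 by push_cast; ring, Real.cos_pi_div_four]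
    ring
  rw [e] at h
  rw [Complex.ofReal_add, Complex.ofReal_one]
  exact add_mem (one_mem _) h

/-- The golden ratio `τ` lies in `ℤ[ω]` for `n = 10`. -/
theorem tau_mem : (Real.goldenRatio : ℂ) ∈ cyclotomicIntegers 10 := by
  have h := two_cos_mem 10 (by norm_num)
  have e : 2 * Real.cos (2 * Real.pi / (10 : ℕ)) = Real.goldenRatio := by
    rw [show 2 * Real.pi / (10 : ℕ) = Real.pi / 5 by push_cast; ring, Real.cos_pi_div_five,
      Real.goldenRatio]
    ring
  rwa [e] at h

/-- `δ = 1 + √2` as an element of `ℤ[exp(2πi/8)]`. -/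
def delta : cyclotomicIntegers 8 := ⟨((1 + √2 : ℝ) : ℂ), delta_mem⟩

/-- `τ = (1 + √5)/2` as an element of `ℤ[exp(2πi/10)]`. -/
def tau : cyclotomicIntegers 10 := ⟨(Real.goldenRatio : ℂ), tau_mem⟩

end

end PisotCyclotomic

open PisotCyclotomic

/-! Write γ = σ(β) and K for the attractor. The spectrum lies in Σ(int K): 0 is interior to K
because some disc is covered by its own images under z ↦ a + γz (`disc_step`), and each of these
maps sends int K into int K.

For the converse, β is a unit and σ permutes the digits, so a digit step σ(x) = a + γz lifts to x =
b + βy with σ(y) = z (`exists_lift_step`). Such steps bring |x| down to about 1/(β - 1). For a set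
closed under them it therefore suffices to treat the elements with |x| ≤ 1/(β - 1) + ε
(`mem_digitSpectrum_of_descent`), and a bounded conjugate leaves only finitely many. For δ only 0 is
left. For τ the attractor is a decagon, the open decagon admits digit steps that stay inside it
(`decagon_step`), and the remaining elements have explicit expansions.

For τ² the small elements are 0 and the ω^k/τ. The conjugates of the latter are vertices of a
decagon of radius τ, on the boundary of a disc that contains K, and a descent may end there. Suppose
that σ(x) is interior and x is not in the spectrum. Adding β^k w to x, with σ(w) short in any of ten
directions, keeps the conjugate in K for large k. Expanding k digits and taking w away leaves a
remainder of x of the form ω^j/τ, whose conjugate has negative inner product with σ(w). So every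
direction has such a vertex opposing it. Yet two remainders of x at equal depth are never opposite
(`norm_sub_lt_of_expands`) and never differ by the second longest diagonal
(`not_expands_of_diagonal`); `false_of_directions` shows that this is impossible. -/

namespace PisotCyclotomic

open Complex ComplexConjugate

/-! ### Digit expansions, attractors and descent for a general order n -/

section General

theorem isPrimitiveRoot_rootOfUnity {n : ℕ} (hn : n ≠ 0) : IsPrimitiveRoot (rootOfUnity n) n :=
  Complex.isPrimitiveRoot_exp n hn

theorem zpow_rootOfUnity_pow {n : ℕ} (hn : n ≠ 0) (k : ℤ) : (rootOfUnity n ^ k) ^ n = 1 := by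
  rw [← zpow_natCast, ← zpow_mul, mul_comm, zpow_mul, zpow_natCast,
    (isPrimitiveRoot_rootOfUnity hn).pow_eq_one, one_zpow]

theorem mem_alphabet_iff {n : ℕ} (hn : n ≠ 0) {z : ℂ} : z ∈ alphabet n ↔ z = 0 ∨ z ^ n = 1 := by
  have hp := isPrimitiveRoot_rootOfUnity hn
  constructor
  · rintro (⟨j, rfl⟩ | rfl)
    · exact Or.inr (zpow_rootOfUnity_pow hn j)
    · exact Or.inl rfl
  · rintro (rfl | h)
    · exact Or.inr rfl
    · have : NeZero n := ⟨hn⟩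
      obtain ⟨i, _, hi⟩ := hp.eq_pow_of_pow_eq_one h
      exact Or.inl ⟨i, by simpa using hi⟩

theorem zero_mem_alphabet (n : ℕ) : (0 : ℂ) ∈ alphabet n := Or.inr rfl

theorem norm_le_one_of_mem_alphabet {n : ℕ} (hn : n ≠ 0) {z : ℂ} (hz : z ∈ alphabet n) :
    ‖z‖ ≤ 1 := by
  rcases (mem_alphabet_iff hn).1 hz with rfl | h
  · simp
  · exact (Complex.norm_eq_one_of_pow_eq_one h hn).le

theorem mem_cyclotomicIntegers_of_mem_alphabet {n : ℕ} (hn : n ≠ 0) {z : ℂ}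
    (hz : z ∈ alphabet n) : z ∈ cyclotomicIntegers n := by
  have : NeZero n := ⟨hn⟩
  rcases (mem_alphabet_iff hn).1 hz with rfl | h
  · exact zero_mem _
  · obtain ⟨i, _, rfl⟩ := (isPrimitiveRoot_rootOfUnity hn).eq_pow_of_pow_eq_one h
    have h1 : rootOfUnity n ∈ cyclotomicIntegers n := Algebra.subset_adjoin rfl
    exact pow_mem h1 i

/-- The generator `ω` of `ℤ[ω]`. -/
noncomputable def gen (n : ℕ) : cyclotomicIntegers n := ⟨rootOfUnity n, Algebra.subset_adjoin rfl⟩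

theorem gen_pow {n : ℕ} (hn : n ≠ 0) : gen n ^ n = 1 :=
  Subtype.ext (by simpa [gen] using (isPrimitiveRoot_rootOfUnity hn).pow_eq_one)

/-- Being a digit is algebraic: b = 0 or bⁿ = 1. -/
theorem map_mem_alphabet_iff {n : ℕ} (hn : n ≠ 0)
    (σ : cyclotomicIntegers n ≃+* cyclotomicIntegers n) (a : cyclotomicIntegers n) :
    (σ a : ℂ) ∈ alphabet n ↔ (a : ℂ) ∈ alphabet n := by
  have key : ∀ b : cyclotomicIntegers n, (b : ℂ) ∈ alphabet n ↔ b = 0 ∨ b ^ n = 1 := by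
    intro b
    rw [mem_alphabet_iff hn, ← Subtype.coe_inj, ← Subtype.coe_inj]
    simp
  rw [key, key, EmbeddingLike.map_eq_zero_iff, ← map_pow σ, EmbeddingLike.map_eq_one_iff]

theorem exists_lift_alphabet {n : ℕ} (hn : n ≠ 0)
    (σ : cyclotomicIntegers n ≃+* cyclotomicIntegers n) {a : ℂ} (ha : a ∈ alphabet n) :
    ∃ b : cyclotomicIntegers n, (b : ℂ) ∈ alphabet n ∧ (σ b : ℂ) = a := by
  refine ⟨σ.symm ⟨a, mem_cyclotomicIntegers_of_mem_alphabet hn ha⟩, ?_, ?_⟩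
  · rw [← map_mem_alphabet_iff hn σ]
    simpa using ha
  · simp

/-- Since β is a unit, x - b is divisible by β in ℤ[ω] for any digit b; a digit step in the window
thus always lifts. -/
theorem exists_lift_step {n : ℕ} (hn : n ≠ 0)
    (σ : cyclotomicIntegers n ≃+* cyclotomicIntegers n) {β β' : cyclotomicIntegers n}
    (hβ : β * β' = 1) (x : cyclotomicIntegers n) {a z : ℂ} (ha : a ∈ alphabet n)
    (hx : (σ x : ℂ) = a + σ β * z) :
    ∃ b : cyclotomicIntegers n, (b : ℂ) ∈ alphabet n ∧ ∃ y, x = b + β * y ∧ (σ y : ℂ) = z := by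
  obtain ⟨b, hb, hba⟩ := exists_lift_alphabet hn σ ha
  refine ⟨b, hb, β' * (x - b), ?_, ?_⟩
  · rw [← mul_assoc, hβ]; ring
  · have h1 : (σ β : ℂ) * σ β' = 1 := by
      rw [← MulMemClass.coe_mul, ← map_mul, hβ]; simp
    rw [map_mul, map_sub, MulMemClass.coe_mul, AddSubgroupClass.coe_sub, hba, hx]
    linear_combination z * h1

/-! ### The attractor -/

theorem norm_le_of_mem_attractor {B : Set ℂ} (hB : ∀ a ∈ B, ‖a‖ ≤ 1) {γ : ℂ} (hγ : ‖γ‖ < 1)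
    {z : ℂ} (hz : z ∈ attractor γ B) : ‖z‖ ≤ 1 / (1 - ‖γ‖) := by
  obtain ⟨a, ha, hs⟩ := hz
  have hg := hasSum_geometric_of_lt_one (norm_nonneg γ) hγ
  rw [one_div, ← hs.tsum_eq]
  refine tsum_of_norm_bounded hg fun i => ?_
  rw [norm_mul, norm_pow]
  exact mul_le_of_le_one_left (by positivity) (hB _ (ha i))

theorem exists_step_of_mem_attractor {B : Set ℂ} {γ : ℂ} (hγ : γ ≠ 0) {z : ℂ}
    (hz : z ∈ attractor γ B) : ∃ a ∈ B, ∃ z' ∈ attractor γ B, z = a + γ * z' := by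
  obtain ⟨a, ha, hs⟩ := hz
  refine ⟨a 0, ha 0, (z - a 0) / γ, ⟨fun i => a (i + 1), fun i => ha _, ?_⟩, ?_⟩
  · have h := (hasSum_nat_add_iff' 1).2 hs
    have h2 := h.div_const γ
    simp only [Finset.range_one, Finset.sum_singleton, pow_zero, mul_one] at h2
    refine h2.congr_fun fun i => ?_
    rw [pow_succ]
    field_simp
  · field_simp
    ring

theorem step_mem_attractor {B : Set ℂ} {γ a z : ℂ} (ha : a ∈ B) (hz : z ∈ attractor γ B) :
    a + γ * z ∈ attractor γ B := by
  obtain ⟨b, hb, hs⟩ := hz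
  refine ⟨fun i => Nat.casesOn i a b, fun i => by cases i <;> simp [ha, hb], ?_⟩
  refine (hasSum_nat_add_iff' 1).1 ?_
  have h := hs.mul_left γ
  simp only [Finset.range_one, Finset.sum_singleton, pow_zero, mul_one]
  change HasSum (fun i => b i * γ ^ (i + 1)) (a + γ * z - a)
  rw [add_sub_cancel_left]
  refine h.congr_fun fun i => ?_
  rw [pow_succ]
  ring

/-- Iterating the step produces the digits; after N of them the error is γ^N times a point of the
bounded set S. -/
theorem subset_attractor_of_step {B S : Set ℂ} (hB : ∀ a ∈ B, ‖a‖ ≤ 1) {γ : ℂ} (hγ : ‖γ‖ < 1)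
    {R : ℝ} (hR : ∀ z ∈ S, ‖z‖ ≤ R) (hS : ∀ z ∈ S, ∃ a ∈ B, ∃ z' ∈ S, z = a + γ * z') :
    S ⊆ attractor γ B := by
  intro z hz
  choose! d hd f hf hdf using hS
  let s : ℕ → ℂ := fun i => f^[i] z
  have hs : ∀ i, s i ∈ S := by
    intro i
    induction i with
    | zero => exact hz
    | succ i ih =>
      simp only [s, Function.iterate_succ_apply']
      exact hf _ ih
  have hsucc : ∀ i, s i = d (s i) + γ * s (i + 1) := by
    intro i
    simp only [s, Function.iterate_succ_apply']
    exact hdf _ (hs i)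
  have hpart : ∀ N, ∑ i ∈ Finset.range N, d (s i) * γ ^ i = z - γ ^ N * s N := by
    intro N
    induction N with
    | zero => simp [s]
    | succ N ih =>
      rw [Finset.sum_range_succ, ih]
      linear_combination (-γ ^ N) * hsucc N
  have hsum : Summable fun i => d (s i) * γ ^ i := by
    refine Summable.of_norm_bounded (summable_geometric_of_lt_one (norm_nonneg γ) hγ) fun i => ?_
    rw [norm_mul, norm_pow]
    exact mul_le_of_le_one_left (by positivity) (hB _ (hd _ (hs i)))
  refine ⟨fun i => d (s i), fun i => hd _ (hs i), ?_⟩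
  rw [hsum.hasSum_iff_tendsto_nat]
  simp only [hpart]
  have h0 : Filter.Tendsto (fun N => γ ^ N * s N) Filter.atTop (nhds 0) := by
    refine squeeze_zero_norm (a := fun N => ‖γ‖ ^ N * R) (fun N => ?_) ?_
    · rw [norm_mul, norm_pow]
      exact mul_le_mul_of_nonneg_left (hR _ (hs N)) (by positivity)
    · simpa using (tendsto_pow_atTop_nhds_zero_of_lt_one (norm_nonneg γ) hγ).mul_const R
  simpa using tendsto_const_nhds.sub h0

/-! ### The spectrum -/

theorem zero_mem_digitSpectrum {B : Set ℂ} (h0 : (0 : ℂ) ∈ B) (β : ℂ) :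
    (0 : ℂ) ∈ digitSpectrum B β := ⟨0, fun _ => 0, fun _ => h0, by simp⟩

theorem step_mem_digitSpectrum {B : Set ℂ} {β a z : ℂ} (ha : a ∈ B)
    (hz : z ∈ digitSpectrum B β) : a + β * z ∈ digitSpectrum B β := by
  obtain ⟨N, b, hb, rfl⟩ := hz
  refine ⟨N + 1, fun i => Nat.casesOn i a b, fun i => by cases i <;> simp [ha, hb], ?_⟩
  rw [Finset.sum_range_succ' _ (N + 1), Finset.mul_sum]
  simp only [pow_zero, mul_one]
  rw [add_comm]
  congr 1
  refine Finset.sum_congr rfl fun i _ => ?_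
  rw [pow_succ]
  ring

theorem digitSpectrum_induction {B : Set ℂ} {β : ℂ} {P : ℂ → Prop} (h0 : P 0)
    (hstep : ∀ a ∈ B, ∀ z, P z → P (a + β * z)) {z : ℂ} (hz : z ∈ digitSpectrum B β) : P z := by
  obtain ⟨N, a, ha, rfl⟩ := hz
  generalize N + 1 = N
  induction N generalizing a with
  | zero => simpa using h0
  | succ N ih =>
    have h := hstep _ (ha 0) _ (ih (fun i => a (i + 1)) fun i => ha _)
    convert h using 1
    rw [Finset.sum_range_succ', Finset.mul_sum]
    simp only [pow_zero, mul_one]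
    rw [add_comm]
    congr 1
    refine Finset.sum_congr rfl fun i _ => ?_
    rw [pow_succ]
    ring

/-- Prepending a digit acts on conjugates as the homeomorphism z ↦ σ(a) + γz. It maps K into K,
hence the interior into the interior. -/
theorem digitSpectrum_subset_cutProject {n : ℕ} (hn : n ≠ 0)
    (σ : cyclotomicIntegers n ≃+* cyclotomicIntegers n) {β : cyclotomicIntegers n} (hβ : β ≠ 0)
    (h0 : (0 : ℂ) ∈ interior (attractor (σ β) (alphabet n))) :
    digitSpectrum (alphabet n) β ⊆ cutProject σ (interior (attractor (σ β) (alphabet n))) := by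
  intro z hz
  refine digitSpectrum_induction (P := fun z => z ∈ cutProject σ _) ?_ ?_ hz
  · exact ⟨0, by simp, by simpa using h0⟩
  · rintro a ha _ ⟨x, rfl, hx⟩
    refine ⟨⟨a, mem_cyclotomicIntegers_of_mem_alphabet hn ha⟩ + β * x, by simp, ?_⟩
    set b : cyclotomicIntegers n := ⟨a, mem_cyclotomicIntegers_of_mem_alphabet hn ha⟩
    have hb : (σ b : ℂ) ∈ alphabet n := (map_mem_alphabet_iff hn σ b).2 ha
    have hγ : (σ β : ℂ) ≠ 0 := by simpa using hβ
    let e : ℂ ≃ₜ ℂ := (Homeomorph.mulLeft₀ (σ β : ℂ) hγ).trans (Homeomorph.addLeft (σ b : ℂ))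
    have he : ∀ z, e z = σ b + σ β * z := fun z => rfl
    have hmem : e (σ x) ∈ e '' interior (attractor (σ β) (alphabet n)) := ⟨_, hx, rfl⟩
    rw [e.image_interior] at hmem
    have : (σ (b + β * x) : ℂ) = e (σ x) := by rw [he]; simp
    rw [this]
    refine interior_mono ?_ hmem
    rintro _ ⟨w, hw, rfl⟩
    exact step_mem_attractor hb hw

/-- From x = a + βy follows |y| ≤ (|x| + 1)/b, a contraction with fixed point 1/(b - 1): the excess
over it shrinks by b at each step. -/
theorem mem_digitSpectrum_of_descent {n : ℕ} (hn : n ≠ 0) {β : cyclotomicIntegers n} {b : ℝ}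
    (hβ : (β : ℂ) = b) (hb : 1 < b) {S : Set (cyclotomicIntegers n)}
    (hS : ∀ x ∈ S, ∃ a : cyclotomicIntegers n, (a : ℂ) ∈ alphabet n ∧ ∃ y ∈ S, x = a + β * y)
    {ε : ℝ} (hε : 0 < ε)
    (hfin : ∀ x ∈ S, ‖(x : ℂ)‖ ≤ 1 / (b - 1) + ε → (x : ℂ) ∈ digitSpectrum (alphabet n) β)
    {x : cyclotomicIntegers n} (hx : x ∈ S) : (x : ℂ) ∈ digitSpectrum (alphabet n) β := by
  have main : ∀ k : ℕ, ∀ x ∈ S, ‖(x : ℂ)‖ ≤ 1 / (b - 1) + ε * b ^ k →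
      (x : ℂ) ∈ digitSpectrum (alphabet n) β := by
    intro k
    induction k with
    | zero => intro x hx h; exact hfin x hx (by simpa using h)
    | succ k ih =>
      intro x hx h
      obtain ⟨a, ha, y, hy, hxy⟩ := hS x hx
      have hc : (x : ℂ) = a + β * y := by rw [hxy]; simp
      rw [hc]
      refine step_mem_digitSpectrum ha (ih y hy ?_)
      have h1 : b * ‖(y : ℂ)‖ ≤ ‖(x : ℂ)‖ + 1 := by
        have h2 : (b : ℂ) * y = x - a := by rw [hc, hβ]; ring
        have h3 := norm_sub_le (x : ℂ) a
        rw [← h2, norm_mul, Complex.norm_real, Real.norm_of_nonneg (by linarith)] at h3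
        linarith [norm_le_one_of_mem_alphabet hn ha]
      have h4 : b * (1 / (b - 1) + ε * b ^ k) = 1 / (b - 1) + ε * b ^ (k + 1) + 1 := by
        have : b - 1 ≠ 0 := by linarith
        field_simp
        ring
      refine le_of_mul_le_mul_left ?_ (by linarith : 0 < b)
      linarith
  obtain ⟨k, hk⟩ := pow_unbounded_of_one_lt (‖(x : ℂ)‖ / ε) hb
  refine main k x hx ?_
  rw [div_lt_iff₀ hε] at hk
  have : 0 < 1 / (b - 1) := by have : 0 < b - 1 := by linarith
                               positivity
  linarith

/-! ### Sectors and the self-covering disc -/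

theorem exists_rotation {n : ℕ} (hn : n ≠ 0) (z : ℂ) : ∃ j : ℤ, ∃ φ : ℝ, |φ| ≤ Real.pi / n ∧
    z = rootOfUnity n ^ j * (‖z‖ * Complex.exp (φ * I)) := by
  have hn' : (0 : ℝ) < n := by positivity
  set j := round (z.arg * n / (2 * Real.pi)) with hj
  refine ⟨j, z.arg - 2 * Real.pi * j / n, ?_, ?_⟩
  · have h := abs_sub_round (z.arg * n / (2 * Real.pi))
    rw [← hj] at h
    have e : z.arg - 2 * Real.pi * j / n
        = (2 * Real.pi / n) * (z.arg * n / (2 * Real.pi) - j) := by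
      field_simp
    rw [e, abs_mul, abs_of_pos (by positivity)]
    calc _ ≤ 2 * Real.pi / n * (1 / 2) := by gcongr
      _ = _ := by ring
  · have h1 : rootOfUnity n ^ j = Complex.exp ((2 * Real.pi * j / n : ℝ) * I) := by
      rw [rootOfUnity, ← Complex.exp_int_mul]
      congr 1
      push_cast
      ring
    rw [h1, mul_left_comm, ← Complex.exp_add, ← add_mul, ← Complex.ofReal_add]
    conv_lhs => rw [← Complex.norm_mul_exp_arg_mul_I z]
    congr 4
    ring

theorem exists_digit_re_ge {n : ℕ} (hn : n ≠ 0) (z : ℂ) :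
    ∃ a : ℂ, a ^ n = 1 ∧ ‖z‖ * Real.cos (Real.pi / n) ≤ (z * conj a).re := by
  obtain ⟨j, φ, hφ, hz⟩ := exists_rotation hn z
  have hp := zpow_rootOfUnity_pow hn j
  refine ⟨_, hp, ?_⟩
  have hnorm := Complex.norm_eq_one_of_pow_eq_one hp hn
  have h1 : rootOfUnity n ^ j * conj (rootOfUnity n ^ j) = 1 := by
    rw [Complex.mul_conj, Complex.normSq_eq_norm_sq, hnorm]; simp
  have h2 : z * conj (rootOfUnity n ^ j) = ‖z‖ * Complex.exp (φ * I) := by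
    conv_lhs => rw [hz]
    linear_combination (↑‖z‖ * Complex.exp (φ * I)) * h1
  rw [h2, Complex.re_ofReal_mul, Complex.exp_ofReal_mul_I_re, ← Real.cos_abs φ]
  gcongr
  refine Real.cos_le_cos_of_nonneg_of_le_pi (abs_nonneg _) ?_ hφ
  refine div_le_self Real.pi_pos.le ?_
  exact_mod_cast Nat.one_le_iff_ne_zero.2 hn

theorem norm_sub_sq (z a : ℂ) : ‖z - a‖ ^ 2 = ‖z‖ ^ 2 + ‖a‖ ^ 2 - 2 * (z * conj a).re := by
  rw [← Complex.normSq_eq_norm_sq, ← Complex.normSq_eq_norm_sq, ← Complex.normSq_eq_norm_sq,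
    Complex.normSq_sub]

/-- The digit 0 serves the inner disc of radius |γ|r. In the remaining annulus a nearest root of
unity works, at angle at most π/n from z; `h1` and `h2` are the worst case on the inner and outer
circle. -/
theorem disc_step {n : ℕ} (hn : n ≠ 0) {γ : ℂ} (hγ0 : γ ≠ 0) (hγ : ‖γ‖ < 1) {r : ℝ} (hr : 0 < r)
    (h1 : 1 ≤ 2 * (‖γ‖ * r) * Real.cos (Real.pi / n))
    (h2 : r ^ 2 + 1 ≤ 2 * r * Real.cos (Real.pi / n) + (‖γ‖ * r) ^ 2)
    {z : ℂ} (hz : ‖z‖ ≤ r) : ∃ a ∈ alphabet n, ∃ z', ‖z'‖ ≤ r ∧ z = a + γ * z' := by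
  have hg : 0 < ‖γ‖ := norm_pos_iff.2 hγ0
  suffices h : ∃ a ∈ alphabet n, ‖z - a‖ ≤ ‖γ‖ * r by
    obtain ⟨a, ha, h⟩ := h
    refine ⟨a, ha, (z - a) / γ, ?_, by field_simp; ring⟩
    rw [norm_div, div_le_iff₀ hg]
    linarith
  by_cases hc : ‖z‖ ≤ ‖γ‖ * r
  · exact ⟨0, zero_mem_alphabet n, by simpa using hc⟩
  push Not at hc
  obtain ⟨a, ha, hre⟩ := exists_digit_re_ge hn z
  refine ⟨a, (mem_alphabet_iff hn).2 (Or.inr ha), ?_⟩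
  refine le_of_sq_le_sq ?_ (by positivity)
  rw [norm_sub_sq, Complex.norm_eq_one_of_pow_eq_one ha hn]
  set c := Real.cos (Real.pi / n)
  set ρ := ‖z‖
  set s := ‖γ‖ * r
  have hs : 0 < r - s := by
    have : ‖γ‖ * r < 1 * r := by gcongr
    linarith
  -- The quadratic is convex in ρ and nonpositive at ρ = s and ρ = r, so it is nonpositive between;
  -- r - s clears the denominator of the chord.
  have key : (r - s) * (ρ ^ 2 + 1 - 2 * ρ * c - s ^ 2) ≤ 0 := by
    nlinarith [mul_nonneg (sub_nonneg.2 hc.le) (sub_nonneg.2 hz), mul_nonneg (mul_nonneg (sub_nonneg.2 hc.le) (sub_nonneg.2 hz)) hs.le,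
      mul_nonneg (sub_nonneg.2 hc.le) (sub_nonneg.2 h2), mul_nonneg (sub_nonneg.2 hz) (sub_nonneg.2 h1)]
  have := nonpos_of_mul_nonpos_right key hs
  nlinarith

theorem ball_subset_attractor {n : ℕ} (hn : n ≠ 0) {γ : ℂ} (hγ0 : γ ≠ 0) (hγ : ‖γ‖ < 1) {r : ℝ}
    (hr : 0 < r) (h1 : 1 ≤ 2 * (‖γ‖ * r) * Real.cos (Real.pi / n))
    (h2 : r ^ 2 + 1 ≤ 2 * r * Real.cos (Real.pi / n) + (‖γ‖ * r) ^ 2) :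
    {z : ℂ | ‖z‖ ≤ r} ⊆ attractor γ (alphabet n) :=
  subset_attractor_of_step (fun _ => norm_le_one_of_mem_alphabet hn) hγ (fun _ h => h)
    fun _ hz => disc_step hn hγ0 hγ hr h1 h2 hz

theorem zero_mem_interior_attractor {n : ℕ} (hn : n ≠ 0) {γ : ℂ} (hγ0 : γ ≠ 0) (hγ : ‖γ‖ < 1)
    {r : ℝ} (hr : 0 < r) (h1 : 1 ≤ 2 * (‖γ‖ * r) * Real.cos (Real.pi / n))
    (h2 : r ^ 2 + 1 ≤ 2 * r * Real.cos (Real.pi / n) + (‖γ‖ * r) ^ 2) :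
    (0 : ℂ) ∈ interior (attractor γ (alphabet n)) := by
  refine mem_interior_iff_mem_nhds.2 (Filter.mem_of_superset (Metric.ball_mem_nhds 0 hr) ?_)
  refine subset_trans (fun z hz => ?_) (ball_subset_attractor hn hγ0 hγ hr h1 h2)
  exact (mem_ball_zero_iff.1 hz).le

theorem isBounded_attractor {n : ℕ} (hn : n ≠ 0) {γ : ℂ} (hγ : ‖γ‖ < 1) :
    Bornology.IsBounded (attractor γ (alphabet n)) :=
  isBounded_iff_forall_norm_le.2
    ⟨_, fun _ => norm_le_of_mem_attractor (fun _ => norm_le_one_of_mem_alphabet hn) hγ⟩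

theorem isWindow_attractor {n : ℕ} (hn : n ≠ 0) {γ : ℂ} (hγ : ‖γ‖ < 1)
    (h0 : (0 : ℂ) ∈ interior (attractor γ (alphabet n))) :
    IsWindow (interior (attractor γ (alphabet n))) ∧ IsWindow (attractor γ (alphabet n)) :=
  ⟨⟨(isBounded_attractor hn hγ).subset interior_subset, 0, by rwa [interior_interior]⟩,
    isBounded_attractor hn hγ, 0, h0⟩

/-- Every element of `ℤ[ω]` is an integral combination of `1, ω, ω², ω³` when `ω` is a root of a
monic quartic. -/
theorem exists_coords {n : ℕ} {e0 e1 e2 e3 : ℤ}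
    (h : gen n ^ 4 = e0 + e1 * gen n + e2 * gen n ^ 2 + e3 * gen n ^ 3)
    (x : cyclotomicIntegers n) : ∃ c0 c1 c2 c3 : ℤ,
      x = c0 + c1 * gen n + c2 * gen n ^ 2 + c3 * gen n ^ 3 := by
  have hx : (x : ℂ) ∈ (Polynomial.aeval (rootOfUnity n) : Polynomial ℤ →ₐ[ℤ] ℂ).range := by
    rw [← Algebra.adjoin_singleton_eq_range_aeval]; exact x.2
  obtain ⟨p, hp⟩ := hx
  have hp' : x = Polynomial.aeval (gen n) p := by
    refine Subtype.ext ?_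
    rw [← hp]
    have := Polynomial.aeval_algHom_apply (cyclotomicIntegers n).val (gen n) p
    exact this
  rw [hp']
  clear hp' hp
  induction p using Polynomial.induction_on with
  | C a => exact ⟨a, 0, 0, 0, by simp⟩
  | add p q hp hq =>
    obtain ⟨a0, a1, a2, a3, ha⟩ := hp
    obtain ⟨b0, b1, b2, b3, hb⟩ := hq
    exact ⟨a0 + b0, a1 + b1, a2 + b2, a3 + b3, by rw [map_add, ha, hb]; push_cast; ring⟩
  | monomial k a ih =>
    obtain ⟨a0, a1, a2, a3, ha⟩ := ih
    refine ⟨a3 * e0, a0 + a3 * e1, a1 + a3 * e2, a2 + a3 * e3, ?_⟩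
    rw [pow_succ, ← mul_assoc, map_mul, ha, Polynomial.aeval_X]
    push_cast
    linear_combination (a3 : cyclotomicIntegers n) * h

end General

/-! ### Automorphisms of ℤ[ω] and the conjugates of δ and τ -/

section Automorphisms

theorem coe_gen (n : ℕ) : (gen n : ℂ) = rootOfUnity n := rfl

theorem minpoly_rootOfUnity {n : ℕ} (hn : n ≠ 0) :
    minpoly ℤ (rootOfUnity n) = Polynomial.cyclotomic n ℤ :=
  (Polynomial.cyclotomic_eq_minpoly (isPrimitiveRoot_rootOfUnity hn) (Nat.pos_of_ne_zero hn)).symm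

/-- The ring endomorphism of `ℤ[ω]` with `ω ↦ ω ^ k`, for `k` coprime to `n`. -/
theorem exists_algHom_gen {n : ℕ} (hn : n ≠ 0) {k : ℕ} (hk : k.Coprime n) :
    ∃ f : cyclotomicIntegers n →ₐ[ℤ] cyclotomicIntegers n, f (gen n) = gen n ^ k := by
  have hp := isPrimitiveRoot_rootOfUnity hn
  have hint : IsIntegral ℤ (rootOfUnity n) := hp.isIntegral (Nat.pos_of_ne_zero hn)
  let pb := Algebra.adjoin.powerBasis' hint
  have hgen : pb.gen = gen n := Algebra.adjoin.powerBasis'_gen hint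
  have hmin : minpoly ℤ pb.gen = Polynomial.cyclotomic n ℤ :=
    (Algebra.adjoin.powerBasis'_minpoly_gen hint).symm.trans (minpoly_rootOfUnity hn)
  have hroot : Polynomial.aeval (gen n ^ k) (minpoly ℤ pb.gen) = 0 := by
    rw [hmin]
    refine Subtype.ext ?_
    have h1 := Polynomial.aeval_algHom_apply (cyclotomicIntegers n).val (gen n ^ k)
      (Polynomial.cyclotomic n ℤ)
    have h2 : Polynomial.aeval (rootOfUnity n ^ k) (Polynomial.cyclotomic n ℤ) = 0 := by
      have h3 := (hp.pow_of_coprime k hk).isRoot_cyclotomic (Nat.pos_of_ne_zero hn)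
      rw [Polynomial.IsRoot.def, ← Polynomial.map_cyclotomic_int, Polynomial.eval_map] at h3
      exact h3
    exact h1.symm.trans h2
  exact ⟨pb.lift _ hroot, (congrArg _ hgen.symm).trans (pb.lift_gen _ hroot)⟩

theorem algHom_ext_gen {n : ℕ} {f g : cyclotomicIntegers n →ₐ[ℤ] cyclotomicIntegers n}
    (h : f (gen n) = g (gen n)) : f = g := by
  refine AlgHom.adjoin_ext fun x hx => ?_
  obtain rfl : x = rootOfUnity n := hx
  exact h

theorem exists_ringEquiv_gen {n : ℕ} (hn : n ≠ 0) {k m : ℕ} (hkm : k * m % n = 1 % n) :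
    ∃ σ : cyclotomicIntegers n ≃+* cyclotomicIntegers n, σ (gen n) = gen n ^ k := by
  have hk : k.Coprime n := Nat.coprime_of_mul_modEq_one m hkm
  have hm : m.Coprime n := Nat.coprime_of_mul_modEq_one k (by rwa [mul_comm] at hkm)
  obtain ⟨f, hf⟩ := exists_algHom_gen hn hk
  obtain ⟨g, hg⟩ := exists_algHom_gen hn hm
  have hpow : gen n ^ (k * m) = gen n := by
    have h1 := pow_eq_pow_mod (k * m) (gen_pow hn)
    have h2 := pow_eq_pow_mod 1 (gen_pow hn)
    rw [h1, hkm, ← h2, pow_one]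
  refine ⟨(AlgEquiv.ofAlgHom f g ?_ ?_).toRingEquiv, hf⟩
  · refine algHom_ext_gen ?_
    rw [AlgHom.comp_apply, hg, map_pow, hf, ← pow_mul, hpow]; rfl
  · refine algHom_ext_gen ?_
    rw [AlgHom.comp_apply, hf, map_pow, hg, ← pow_mul, mul_comm, hpow]; rfl

theorem conj_eq_inv_of_pow {n : ℕ} (hn : n ≠ 0) {z : ℂ} (h : z ^ n = 1) : conj z = z⁻¹ :=
  (Complex.inv_eq_conj (Complex.norm_eq_one_of_pow_eq_one h hn)).symm

theorem pow_pred_eq_inv {n : ℕ} (hn : n ≠ 0) {z : ℂ} (h : z ^ n = 1) : z ^ (n - 1) = z⁻¹ :=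
  eq_inv_of_mul_eq_one_left (by rw [pow_sub_one_mul hn, h])

theorem two_cos_eq {n : ℕ} (hn : n ≠ 0) :
    ((2 * Real.cos (2 * Real.pi / n) : ℝ) : ℂ) = rootOfUnity n + rootOfUnity n ^ (n - 1) := by
  rw [pow_pred_eq_inv hn (isPrimitiveRoot_rootOfUnity hn).pow_eq_one, rootOfUnity,
    ← Complex.exp_neg]
  push_cast
  rw [Complex.two_cos]
  congr 2 <;> ring

theorem delta_eq : delta = 1 + (gen 8 + gen 8 ^ 7) := by
  refine Subtype.ext ?_
  have h := two_cos_eq (n := 8) (by norm_num)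
  rw [show 2 * Real.pi / (8 : ℕ) = Real.pi / 4 by push_cast; ring, Real.cos_pi_div_four] at h
  have h2 : ((√2 : ℝ) : ℂ) = rootOfUnity 8 + rootOfUnity 8 ^ 7 := by
    rw [← h]; congr 1; ring
  have h3 : ((1 + (gen 8 + gen 8 ^ 7) : cyclotomicIntegers 8) : ℂ)
      = 1 + (rootOfUnity 8 + rootOfUnity 8 ^ 7) := by simp [coe_gen]
  rw [h3, ← h2]
  simp [delta]

theorem tau_eq : tau = gen 10 + gen 10 ^ 9 := by
  refine Subtype.ext ?_
  have h := two_cos_eq (n := 10) (by norm_num)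
  rw [show 2 * Real.pi / (10 : ℕ) = Real.pi / 5 by push_cast; ring, Real.cos_pi_div_five] at h
  have h3 : ((gen 10 + gen 10 ^ 9 : cyclotomicIntegers 10) : ℂ)
      = rootOfUnity 10 + rootOfUnity 10 ^ 9 := by simp [coe_gen]
  rw [h3, ← h]
  simp only [tau, Real.goldenRatio]
  congr 1
  ring

theorem delta_sq : delta ^ 2 = delta + delta + 1 := by
  refine Subtype.ext ?_
  have h : (1 + √2 : ℝ) ^ 2 = (1 + √2) + (1 + √2) + 1 := by
    nlinarith [Real.sq_sqrt (show (0 : ℝ) ≤ 2 by norm_num)]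
  have := congrArg (fun x : ℝ => (x : ℂ)) h
  simpa [delta] using this

theorem tau_sq : tau ^ 2 = tau + 1 := by
  refine Subtype.ext ?_
  change (Real.goldenRatio : ℂ) ^ 2 = Real.goldenRatio + 1
  exact_mod_cast congrArg (fun x : ℝ => (x : ℂ)) Real.goldenRatio_sq

theorem exists_automorphism_delta :
    ∃ σ : cyclotomicIntegers 8 ≃+* cyclotomicIntegers 8, ‖(σ delta : ℂ)‖ < 1 := by
  obtain ⟨σ, hσ⟩ := exists_ringEquiv_gen (n := 8) (by norm_num) (k := 3) (m := 3) (by norm_num)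
  refine ⟨σ, ?_⟩
  have h8 := gen_pow (n := 8) (by norm_num)
  have h1 : σ delta = 2 - delta := by
    have h2 := delta_sq
    have h3 : gen 8 * gen 8 ^ 7 = 1 := by rw [← h8]; ring
    rw [delta_eq] at h2 ⊢
    simp only [map_add, map_one, map_pow, hσ]
    have h5 : (gen 8 ^ 3) ^ 7 = (gen 8 ^ 7) ^ 3 := by ring
    rw [h5]
    -- With s = ω + ω⁻¹ the image of δ is 1 + s³ - 3s, and s² = 2.
    generalize gen 8 ^ 7 = p at *
    linear_combination (gen 8 + p) * h2 - (3 * (gen 8 + p)) * h3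
  rw [h1]
  have h4 : ((2 - delta : cyclotomicIntegers 8) : ℂ) = ((1 - √2 : ℝ) : ℂ) := by
    have : ((2 - delta : cyclotomicIntegers 8) : ℂ) = 2 - delta := rfl
    rw [this]
    simp only [delta]
    push_cast
    ring
  rw [h4, Complex.norm_real, Real.norm_eq_abs, abs_lt]
  constructor <;> nlinarith [Real.sq_sqrt (show (0 : ℝ) ≤ 2 by norm_num), Real.sqrt_nonneg 2]

theorem exists_automorphism_tau :
    ∃ σ : cyclotomicIntegers 10 ≃+* cyclotomicIntegers 10, ‖(σ tau : ℂ)‖ < 1 := by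
  obtain ⟨σ, hσ⟩ := exists_ringEquiv_gen (n := 10) (by norm_num) (k := 3) (m := 7) (by norm_num)
  refine ⟨σ, ?_⟩
  have h10 := gen_pow (n := 10) (by norm_num)
  have h1 : σ tau = 1 - tau := by
    have h2 := tau_sq
    have h3 : gen 10 * gen 10 ^ 9 = 1 := by rw [← h10]; ring
    rw [tau_eq] at h2 ⊢
    simp only [map_add, map_pow, hσ]
    have h5 : (gen 10 ^ 3) ^ 9 = (gen 10 ^ 9) ^ 3 := by ring
    rw [h5]
    generalize gen 10 ^ 9 = p at *
    linear_combination (gen 10 + p + 1) * h2 - (3 * (gen 10 + p)) * h3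
  rw [h1]
  have h4 : ((1 - tau : cyclotomicIntegers 10) : ℂ) = ((1 - Real.goldenRatio : ℝ) : ℂ) := by
    have : ((1 - tau : cyclotomicIntegers 10) : ℂ) = 1 - tau := rfl
    rw [this]
    simp [tau]
  rw [h4, Complex.norm_real, Real.norm_eq_abs, abs_lt]
  constructor <;> linarith [Real.one_lt_goldenRatio, Real.goldenRatio_lt_two]

/-- The image is a root of X² - 2X - 1, and only one root is short. All admissible σ thus share the
same γ. -/
theorem map_delta_of_norm_lt_one {σ : cyclotomicIntegers 8 ≃+* cyclotomicIntegers 8}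
    (h : ‖(σ delta : ℂ)‖ < 1) : (σ delta : ℂ) = ((1 - √2 : ℝ) : ℂ) := by
  have h1 : σ delta ^ 2 = σ delta + σ delta + 1 := by
    rw [← map_pow, delta_sq, map_add, map_add, map_one]
  have h2 : (σ delta : ℂ) ^ 2 = σ delta + σ delta + 1 := by
    have := congrArg (fun x : cyclotomicIntegers 8 => (x : ℂ)) h1
    simpa using this
  have hs : ((√2 : ℝ) : ℂ) ^ 2 = 2 := by
    rw [← Complex.ofReal_pow, Real.sq_sqrt (by norm_num)]; simp
  have h3 : ((σ delta : ℂ) - (1 - √2 : ℝ)) * (σ delta - (1 + √2 : ℝ)) = 0 := by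
    push_cast
    linear_combination h2 - hs
  rcases mul_eq_zero.1 h3 with h4 | h4
  · exact sub_eq_zero.1 h4
  · rw [sub_eq_zero.1 h4, Complex.norm_real, Real.norm_eq_abs, abs_lt] at h
    linarith [h.2, Real.sqrt_nonneg 2]

theorem map_tau_of_norm_lt_one {σ : cyclotomicIntegers 10 ≃+* cyclotomicIntegers 10}
    (h : ‖(σ tau : ℂ)‖ < 1) : (σ tau : ℂ) = ((1 - Real.goldenRatio : ℝ) : ℂ) := by
  have h1 : σ tau ^ 2 = σ tau + 1 := by
    rw [← map_pow, tau_sq, map_add, map_one]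
  have h2 : (σ tau : ℂ) ^ 2 = σ tau + 1 := by
    have := congrArg (fun x : cyclotomicIntegers 10 => (x : ℂ)) h1
    simpa using this
  have hs : (Real.goldenRatio : ℂ) ^ 2 = Real.goldenRatio + 1 := by
    exact_mod_cast congrArg (fun x : ℝ => (x : ℂ)) Real.goldenRatio_sq
  have h3 : ((σ tau : ℂ) - (1 - Real.goldenRatio : ℝ)) * (σ tau - Real.goldenRatio) = 0 := by
    rw [Complex.ofReal_sub, Complex.ofReal_one]
    linear_combination h2 - hs
  rcases mul_eq_zero.1 h3 with h4 | h4
  · exact sub_eq_zero.1 h4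
  · rw [sub_eq_zero.1 h4, Complex.norm_real, Real.norm_eq_abs, abs_lt] at h
    linarith [h.2, Real.one_lt_goldenRatio]

end Automorphisms

/-- The squared modulus of an integral combination of the first powers of a unimodular `θ`, in
terms of `t = θ + conj θ`. -/
theorem normSq_quartic {θ : ℂ} (hθ : ‖θ‖ = 1) {t : ℝ} (ht : θ + conj θ = t) (c0 c1 c2 c3 : ℝ) :
    ‖c0 + c1 * θ + c2 * θ ^ 2 + c3 * θ ^ 3‖ ^ 2 =
      c0 ^ 2 + c1 ^ 2 + c2 ^ 2 + c3 ^ 2 + (c0 * c1 + c1 * c2 + c2 * c3) * t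
        + (c0 * c2 + c1 * c3) * (t ^ 2 - 2) + c0 * c3 * (t ^ 3 - 3 * t) := by
  have hc : conj θ = θ⁻¹ := (Complex.inv_eq_conj hθ).symm
  have h0 : θ ≠ 0 := by rintro rfl; simp at hθ
  rw [← Complex.normSq_eq_norm_sq]
  refine Complex.ofReal_injective ?_
  rw [← Complex.mul_conj]
  simp only [map_add, map_mul, map_pow, Complex.conj_ofReal, hc]
  push_cast
  rw [← ht, hc]
  field_simp
  ring

/-! ### Order 8 and β = δ -/

section Eight

theorem gen_eight_pow : gen 8 ^ 4 = -1 := by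
  refine Subtype.ext ?_
  have hp := isPrimitiveRoot_rootOfUnity (n := 8) (by norm_num)
  have h : rootOfUnity 8 ^ 4 = -1 :=
    (hp.pow (by norm_num) (show 8 = 4 * 2 by norm_num)).eq_neg_one_of_two_right
  exact h

/-- The two squared moduli are the conjugate numbers p ± q√2 with p, q integers; both being
nonnegative and bounded leaves very few pairs. -/
theorem eq_zero_of_norm_le_eight {σ : cyclotomicIntegers 8 ≃+* cyclotomicIntegers 8}
    (h : ‖(σ delta : ℂ)‖ < 1) {x : cyclotomicIntegers 8} (hx : ‖(x : ℂ)‖ ^ 2 ≤ 51 / 100)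
    (hσx : ‖(σ x : ℂ)‖ ^ 2 ≤ 3) : x = 0 := by
  obtain ⟨c0, c1, c2, c3, hc⟩ := exists_coords (n := 8) (e0 := -1) (e1 := 0) (e2 := 0) (e3 := 0)
    (by rw [gen_eight_pow]; simp) x
  have hs := Real.sq_sqrt (show (0 : ℝ) ≤ 2 by norm_num)
  have hs1 : √2 < 1.4143 := by rw [Real.sqrt_lt' (by norm_num)]; norm_num
  have hs2 : 1.414 < √2 := by rw [Real.lt_sqrt (by norm_num)]; norm_num
  have hg := gen_pow (n := 8) (by norm_num)
  have hw : (gen 8 : ℂ) ^ 8 = 1 := by simpa using congrArg (fun x : cyclotomicIntegers 8 => (x : ℂ)) hg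
  have hw' : (σ (gen 8) : ℂ) ^ 8 = 1 := by
    have := congrArg (fun x : cyclotomicIntegers 8 => (σ x : ℂ)) hg
    simpa using this
  have ht : (gen 8 : ℂ) + conj (gen 8 : ℂ) = (√2 : ℝ) := by
    have h1 := congrArg (fun x : cyclotomicIntegers 8 => (x : ℂ)) delta_eq
    simp only [AddMemClass.coe_add, OneMemClass.coe_one, SubmonoidClass.coe_pow] at h1
    rw [conj_eq_inv_of_pow (by norm_num) hw, ← pow_pred_eq_inv (by norm_num) hw]
    simp only [delta, Complex.ofReal_add, Complex.ofReal_one] at h1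
    linear_combination -h1
  have ht' : (σ (gen 8) : ℂ) + conj (σ (gen 8) : ℂ) = ((-√2 : ℝ) : ℂ) := by
    have h1 := congrArg (fun x : cyclotomicIntegers 8 => (σ x : ℂ)) delta_eq
    simp only [map_add, map_one, map_pow, AddMemClass.coe_add, OneMemClass.coe_one,
      SubmonoidClass.coe_pow, map_delta_of_norm_lt_one h] at h1
    rw [conj_eq_inv_of_pow (by norm_num) hw', ← pow_pred_eq_inv (by norm_num) hw']
    push_cast at h1 ⊢
    linear_combination -h1
  have e1 := normSq_quartic (Complex.norm_eq_one_of_pow_eq_one hw (by norm_num)) ht c0 c1 c2 c3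
  have e2 := normSq_quartic (Complex.norm_eq_one_of_pow_eq_one hw' (by norm_num)) ht' c0 c1 c2 c3
  have e3 : (x : ℂ) = (c0 : ℝ) + (c1 : ℝ) * gen 8 + (c2 : ℝ) * (gen 8 : ℂ) ^ 2
      + (c3 : ℝ) * (gen 8 : ℂ) ^ 3 := by rw [hc]; simp
  have e4 : (σ x : ℂ) = (c0 : ℝ) + (c1 : ℝ) * σ (gen 8) + (c2 : ℝ) * (σ (gen 8) : ℂ) ^ 2
      + (c3 : ℝ) * (σ (gen 8) : ℂ) ^ 3 := by rw [hc]; simp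
  rw [← e3] at e1
  rw [← e4] at e2
  set p : ℤ := c0 ^ 2 + c1 ^ 2 + c2 ^ 2 + c3 ^ 2 with hp
  set q : ℤ := c0 * c1 + c1 * c2 + c2 * c3 - c0 * c3 with hq
  have hp' : (p : ℝ) = c0 ^ 2 + c1 ^ 2 + c2 ^ 2 + c3 ^ 2 := by rw [hp]; push_cast; ring
  have hq' : (q : ℝ) = c0 * c1 + c1 * c2 + c2 * c3 - c0 * c3 := by rw [hq]; push_cast; ring
  have f1 : ‖(x : ℂ)‖ ^ 2 = p + q * √2 := by
    rw [e1, hp', hq']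
    linear_combination (c0 * c2 + c1 * c3 + c0 * c3 * √2) * hs
  have f2 : ‖(σ x : ℂ)‖ ^ 2 = p - q * √2 := by
    rw [e2, hp', hq']
    linear_combination (c0 * c2 + c1 * c3 - c0 * c3 * √2) * hs
  have n1 := sq_nonneg ‖(x : ℂ)‖
  have n2 := sq_nonneg ‖(σ x : ℂ)‖
  have q1 : q < 1 := by
    have : (q : ℝ) < 1 := by nlinarith
    exact_mod_cast this
  have q2 : -2 < q := by
    have : (-2 : ℝ) < q := by nlinarith
    exact_mod_cast this
  have hq0 : q = 0 ∨ q = -1 := by omega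
  rcases hq0 with h0 | h0
  · rw [h0] at f1
    have p1 : p < 1 := by
      have : (p : ℝ) < 1 := by push_cast at f1; linarith
      exact_mod_cast this
    have p2 : 0 ≤ p := by positivity
    have : p = 0 := by omega
    rw [this] at f1
    have h5 : ‖(x : ℂ)‖ = 0 := by
      have : ‖(x : ℂ)‖ ^ 2 = 0 := by rw [f1]; simp
      exact pow_eq_zero_iff (by norm_num) |>.1 this
    exact Subtype.ext (norm_eq_zero.1 h5)
  -- For q = -1 one would need √2 ≤ p ≤ √2 + 0.51, an interval without integers.
  · exfalso
    rw [h0] at f1 f2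
    push_cast at f1 f2
    have p1 : p < 2 := by
      have : (p : ℝ) < 2 := by linarith
      exact_mod_cast this
    have p2 : 1 < p := by
      have : (1 : ℝ) < p := by linarith
      exact_mod_cast this
    omega

theorem eight_part (σ : cyclotomicIntegers 8 ≃+* cyclotomicIntegers 8)
    (h : ‖(σ delta : ℂ)‖ < 1) :
    IsWindow (interior (attractor (σ delta) (alphabet 8))) ∧
      IsWindow (attractor (σ delta) (alphabet 8)) ∧
      digitSpectrum (alphabet 8) delta =
        cutProject σ (interior (attractor (σ delta) (alphabet 8))) ∧
      digitSpectrum (alphabet 8) delta =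
        cutProject σ (attractor (σ delta) (alphabet 8)) := by
  have hval := map_delta_of_norm_lt_one h
  have hs := Real.sq_sqrt (show (0 : ℝ) ≤ 2 by norm_num)
  have hs1 : √2 < 1.4143 := by rw [Real.sqrt_lt' (by norm_num)]; norm_num
  have hs2 : 1.414 < √2 := by rw [Real.lt_sqrt (by norm_num)]; norm_num
  have hnorm : ‖(σ delta : ℂ)‖ = √2 - 1 := by
    rw [hval, Complex.norm_real, Real.norm_eq_abs, abs_of_neg (by linarith)]; ring
  have hne : (σ delta : ℂ) ≠ 0 := by rw [← norm_ne_zero_iff, hnorm]; linarith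
  have hδ : delta ≠ 0 := by rintro hd; apply hne; rw [hd]; simp
  have h0 : (0 : ℂ) ∈ interior (attractor (σ delta) (alphabet 8)) := by
    set c := Real.cos (Real.pi / (8 : ℕ)) with hc
    have hc8 : c ^ 2 = (2 + √2) / 4 := by
      rw [hc, show Real.pi / (8 : ℕ) = Real.pi / 8 by norm_num, Real.cos_pi_div_eight, div_pow,
        Real.sq_sqrt (by positivity)]
      norm_num
    have hcpos : 0 < c := by
      rw [hc, show Real.pi / (8 : ℕ) = Real.pi / 8 by norm_num, Real.cos_pi_div_eight]
      positivity
    have hg : 0 < √2 - 1 := by linarith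
    have hg1 : (√2 - 1) * (√2 + 1) = 1 := by linear_combination hs
    -- The radius for which both conditions of the self-covering disc are equalities.
    set r : ℝ := (√2 + 1) / (2 * c) with hr
    have hrc : 2 * r * c = √2 + 1 := by rw [hr]; field_simp
    have hr2 : r ^ 2 = 1 + √2 / 2 := by
      rw [hr, div_pow, mul_pow, hc8, div_eq_iff (by positivity)]
      linear_combination (1 / 2 : ℝ) * hs
    refine zero_mem_interior_attractor (by norm_num) hne h (r := r) (by positivity) ?_ ?_
    · rw [hnorm, ← hc]
      nlinarith
    · rw [hnorm, ← hc, hrc, mul_pow, hr2]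
      nlinarith
  have hsub := digitSpectrum_subset_cutProject (by norm_num) σ hδ h0
  have hsub2 : cutProject σ (interior (attractor (σ delta) (alphabet 8))) ⊆
      cutProject σ (attractor (σ delta) (alphabet 8)) :=
    fun z ⟨x, hx, hm⟩ => ⟨x, hx, interior_subset hm⟩
  have hsup : cutProject σ (attractor (σ delta) (alphabet 8)) ⊆
      digitSpectrum (alphabet 8) delta := by
    rintro _ ⟨x, rfl, hx⟩
    refine mem_digitSpectrum_of_descent (b := 1 + √2) (by norm_num) rfl (by linarith)
      (S := {x | (σ x : ℂ) ∈ attractor (σ delta) (alphabet 8)}) ?_ (ε := 0.001) (by norm_num) ?_ hx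
    · intro y hy
      obtain ⟨a, ha, z, hz, hyz⟩ := exists_step_of_mem_attractor hne hy
      obtain ⟨b, hb, y', hy', hyz'⟩ := exists_lift_step (by norm_num) σ (β' := delta - 2)
        (by linear_combination delta_sq) y ha hyz
      exact ⟨b, hb, y', by rw [Set.mem_ofPred_eq, hyz']; exact hz, hy'⟩
    · intro y hy hsmall
      have hb := norm_le_of_mem_attractor (fun _ => norm_le_one_of_mem_alphabet (by norm_num)) h hy
      rw [hnorm] at hb
      have h1 : 1 / (1 - (√2 - 1)) = 1 + √2 / 2 := by
        rw [div_eq_iff (by linarith)]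
        linear_combination (1 / 2 : ℝ) * hs
      have h2 : 1 / (1 + √2 - 1) = √2 / 2 := by
        rw [div_eq_iff (by linarith)]
        linear_combination (-1 / 2 : ℝ) * hs
      rw [h1] at hb
      rw [h2] at hsmall
      have : y = 0 := by
        refine eq_zero_of_norm_le_eight h ?_ ?_
        · have : ‖(y : ℂ)‖ ≤ 0.71 := by linarith
          nlinarith [norm_nonneg (y : ℂ)]
        · have : ‖(σ y : ℂ)‖ ≤ 1.71 := by linarith
          nlinarith [norm_nonneg (σ y : ℂ)]
      rw [this]
      exact zero_mem_digitSpectrum (zero_mem_alphabet 8) _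
  obtain ⟨w1, w2⟩ := isWindow_attractor (by norm_num) h h0
  exact ⟨w1, w2, subset_antisymm hsub (hsub2.trans hsup),
    subset_antisymm (hsub.trans hsub2) hsup⟩

end Eight

/-! ### Integer coordinates for order 10 -/

section Coordinates

/-- Integer coordinates with respect to `1, θ, θ², θ³`, for a primitive tenth root of unity `θ`. -/
abbrev Coords := ℤ × ℤ × ℤ × ℤ

/-- The combination of `1, θ, θ², θ³` with given coordinates. -/
noncomputable def ev (θ : ℂ) (c : Coords) : ℂ :=
  (c.1 : ℝ) + (c.2.1 : ℝ) * θ + (c.2.2.1 : ℝ) * θ ^ 2 + (c.2.2.2 : ℝ) * θ ^ 3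

/-- Coordinates of `θ * x`. -/
def rot (c : Coords) : Coords := (-c.2.2.2, c.1 + c.2.2.2, c.2.1 - c.2.2.2, c.2.2.1 + c.2.2.2)

/-- Coordinates of `(θ + θ⁻¹) * x`. -/
def mulTau (c : Coords) : Coords :=
  (c.1 + c.2.1 - c.2.2.2, c.2.2.1 + c.2.2.2, c.1 + c.2.1, c.2.2.1 + c.2.2.2 - c.1)

/-- Coordinates of `x - y`. -/
def sub (c d : Coords) : Coords :=
  (c.1 - d.1, c.2.1 - d.2.1, c.2.2.1 - d.2.2.1, c.2.2.2 - d.2.2.2)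

/-- Coordinates of `x + y`. -/
def add (c d : Coords) : Coords :=
  (c.1 + d.1, c.2.1 + d.2.1, c.2.2.1 + d.2.2.1, c.2.2.2 + d.2.2.2)

/-- The rational part of `|x|²`, which is `formP + formQ * (θ + θ⁻¹)`. -/
def formP (c : Coords) : ℤ :=
  c.1 ^ 2 + c.2.1 ^ 2 + c.2.2.1 ^ 2 + c.2.2.2 ^ 2 - (c.1 * c.2.2.1 + c.2.1 * c.2.2.2)
    + c.1 * c.2.2.2

/-- The coefficient of `θ + θ⁻¹` in `|x|²`. -/
def formQ (c : Coords) : ℤ :=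
  c.1 * c.2.1 + c.2.1 * c.2.2.1 + c.2.2.1 * c.2.2.2 + (c.1 * c.2.2.1 + c.2.1 * c.2.2.2)
    - c.1 * c.2.2.2

variable {θ : ℂ} {t : ℝ}

/-- Both φ and 1 - φ solve t² = t + 1, so the same coordinates give |x|² (θ = ω) and |σ(x)|² (θ =
σ(ω)). -/
theorem norm_sq_ev (hθ : ‖θ‖ = 1) (ht : θ + conj θ = t) (ht2 : t ^ 2 = t + 1) (c : Coords) :
    ‖ev θ c‖ ^ 2 = formP c + formQ c * t := by
  rw [ev, normSq_quartic hθ ht, formP, formQ]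
  push_cast
  linear_combination (c.1 * c.2.2.1 + c.2.1 * c.2.2.2 + c.1 * c.2.2.2 * (t + 1) : ℝ) * ht2

theorem ev_sub (c d : Coords) : ev θ (sub c d) = ev θ c - ev θ d := by
  simp only [ev, sub]; push_cast; ring

theorem ev_add (c d : Coords) : ev θ (add c d) = ev θ c + ev θ d := by
  simp only [ev, add]; push_cast; ring

theorem two_re_ev (hθ : ‖θ‖ = 1) (ht : θ + conj θ = t) (ht2 : t ^ 2 = t + 1) (c d : Coords) :
    2 * (ev θ c * conj (ev θ d)).re = (formP c + formP d - formP (sub c d) : ℤ)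
      + (formQ c + formQ d - formQ (sub c d) : ℤ) * t := by
  have h := norm_sub_sq (ev θ c) (ev θ d)
  rw [← ev_sub, norm_sq_ev hθ ht ht2, norm_sq_ev hθ ht ht2, norm_sq_ev hθ ht ht2] at h
  push_cast
  linear_combination h

theorem sq_eq_of_add_conj (hθ : ‖θ‖ = 1) (ht : θ + conj θ = t) : θ ^ 2 = t * θ - 1 := by
  have h : θ * conj θ = 1 := by rw [Complex.mul_conj, Complex.normSq_eq_norm_sq, hθ]; simp
  linear_combination θ * ht - h

theorem pow_four_eq (hθ : ‖θ‖ = 1) (ht : θ + conj θ = t) (ht2 : t ^ 2 = t + 1) :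
    θ ^ 4 = θ ^ 3 - θ ^ 2 + θ - 1 := by
  have h := sq_eq_of_add_conj hθ ht
  have h2 : (t : ℂ) ^ 2 = t + 1 := by exact_mod_cast congrArg (fun x : ℝ => (x : ℂ)) ht2
  linear_combination (θ ^ 2 - (1 - t) * θ + 1) * h + θ ^ 2 * h2

theorem ev_rot (hθ : ‖θ‖ = 1) (ht : θ + conj θ = t) (ht2 : t ^ 2 = t + 1) (c : Coords) :
    ev θ (rot c) = θ * ev θ c := by
  have h := pow_four_eq hθ ht ht2
  simp only [ev, rot]
  push_cast
  linear_combination (-(c.2.2.2 : ℂ)) * h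

theorem ev_rot_iterate (hθ : ‖θ‖ = 1) (ht : θ + conj θ = t) (ht2 : t ^ 2 = t + 1) (k : ℕ)
    (c : Coords) : ev θ (rot^[k] c) = θ ^ k * ev θ c := by
  induction k with
  | zero => simp
  | succ k ih => rw [Function.iterate_succ_apply', ev_rot hθ ht ht2, ih]; ring

theorem ev_one : ev θ (1, 0, 0, 0) = 1 := by simp [ev]

/-- The form 2P + Q is |x|² + |σ(x)|². After alternating the signs of the coordinates it becomes
(5/2)Σxᵢ² - (1/2)(Σxᵢ)², whose inverse matrix has diagonal entries 4/5. This confines the elements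
small in both embeddings to a box. -/
theorem sq_coords_le (c : Coords) :
    5 * c.1 ^ 2 ≤ 4 * (2 * formP c + formQ c) ∧ 5 * c.2.1 ^ 2 ≤ 4 * (2 * formP c + formQ c) ∧
      5 * c.2.2.1 ^ 2 ≤ 4 * (2 * formP c + formQ c) ∧
      5 * c.2.2.2 ^ 2 ≤ 4 * (2 * formP c + formQ c) := by
  obtain ⟨a, b, c, d⟩ := c
  simp only [formP, formQ]
  refine ⟨?_, ?_, ?_, ?_⟩
  · nlinarith [sq_nonneg (3 * a - 2 * (-b + c - d)), sq_nonneg (b + c), sq_nonneg (c + d),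
      sq_nonneg (b - d)]
  · nlinarith [sq_nonneg (3 * b - 2 * (-a - c + d)), sq_nonneg (a - c), sq_nonneg (c + d),
      sq_nonneg (a + d)]
  · nlinarith [sq_nonneg (3 * c - 2 * (a - b - d)), sq_nonneg (a + b), sq_nonneg (b - d),
      sq_nonneg (a + d)]
  · nlinarith [sq_nonneg (3 * d - 2 * (-a + b - c)), sq_nonneg (a + b), sq_nonneg (b + c),
      sq_nonneg (a - c)]

theorem ev_mulTau (hθ : ‖θ‖ = 1) (ht : θ + conj θ = t) (ht2 : t ^ 2 = t + 1) (c : Coords) :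
    ev θ (mulTau c) = t * ev θ c := by
  have h := pow_four_eq hθ ht ht2
  have h1 := sq_eq_of_add_conj hθ ht
  have h0 : θ ≠ 0 := by rintro rfl; simp at hθ
  -- Because θ⁻¹ = 1 - θ + θ² - θ³.
  have h3 : (t : ℂ) = 1 + θ ^ 2 - θ ^ 3 := by
    refine mul_left_cancel₀ h0 ?_
    linear_combination -h1 + h
  rw [h3]
  simp only [ev, mulTau]
  push_cast
  linear_combination (c.2.1 + c.2.2.1 * θ + c.2.2.2 * (θ ^ 2 - 1) : ℂ) * h

/-- A rational criterion that follows from `p + q φ < 0`. -/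
def isNeg (p q : ℤ) : Bool := decide (1000 * p + 1618 * q < 0) || decide (10000 * p + 16181 * q < 0)

theorem goldenRatio_bounds : (1.618 : ℝ) < Real.goldenRatio ∧ Real.goldenRatio < 1.6181 := by
  have h := Real.goldenRatio_sq
  have h1 := Real.one_lt_goldenRatio
  constructor <;> nlinarith

/-- Only this implication is needed: `isNeg` occurs as a hypothesis of the finite checks, so a
weaker condition there makes them stronger. -/
theorem isNeg_of_lt {p q : ℤ} (h : (p : ℝ) + q * Real.goldenRatio < 0) : isNeg p q = true := by
  obtain ⟨h1, h2⟩ := goldenRatio_bounds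
  simp only [isNeg, Bool.or_eq_true, decide_eq_true_eq]
  rcases le_total 0 q with hq | hq
  · left
    have hq' : (0 : ℝ) ≤ q := by exact_mod_cast hq
    have : (1000 * p + 1618 * q : ℝ) < 0 := by nlinarith
    exact_mod_cast this
  · right
    have hq' : (q : ℝ) ≤ 0 := by exact_mod_cast hq
    have : (10000 * p + 16181 * q : ℝ) < 0 := by nlinarith
    exact_mod_cast this

theorem isNeg_of_lt_div {p q : ℤ} {m : ℕ} (hm : 0 < m) {b : ℤ}
    (h : (p : ℝ) + q * Real.goldenRatio < b / m) : isNeg (m * p - b) (m * q) = true := by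
  refine isNeg_of_lt ?_
  have hm' : (0 : ℝ) < m := by exact_mod_cast hm
  rw [lt_div_iff₀ hm'] at h
  push_cast
  linarith

end Coordinates

/-! ### The two embeddings of ℤ[ω] for order 10 -/

section Ten

theorem gen_ten_pow_coe : (gen 10 : ℂ) ^ 10 = 1 := by
  simpa using congrArg (fun x : cyclotomicIntegers 10 => (x : ℂ)) (gen_pow (n := 10) (by norm_num))

theorem map_gen_ten_pow_coe (σ : cyclotomicIntegers 10 ≃+* cyclotomicIntegers 10) :
    (σ (gen 10) : ℂ) ^ 10 = 1 := by
  simpa using congrArg (fun x : cyclotomicIntegers 10 => (σ x : ℂ)) (gen_pow (n := 10) (by norm_num))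

theorem gen_ten_add_conj : (gen 10 : ℂ) + conj (gen 10 : ℂ) = Real.goldenRatio := by
  have h1 := congrArg (fun x : cyclotomicIntegers 10 => (x : ℂ)) tau_eq
  simp only [AddMemClass.coe_add, SubmonoidClass.coe_pow] at h1
  rw [conj_eq_inv_of_pow (by norm_num) gen_ten_pow_coe,
    ← pow_pred_eq_inv (by norm_num) gen_ten_pow_coe]
  exact h1.symm

theorem map_gen_ten_add_conj {σ : cyclotomicIntegers 10 ≃+* cyclotomicIntegers 10}
    (h : ‖(σ tau : ℂ)‖ < 1) :
    (σ (gen 10) : ℂ) + conj (σ (gen 10) : ℂ) = ((1 - Real.goldenRatio : ℝ) : ℂ) := by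
  have h1 := congrArg (fun x : cyclotomicIntegers 10 => (σ x : ℂ)) tau_eq
  simp only [map_add, map_pow, AddMemClass.coe_add, SubmonoidClass.coe_pow,
    map_tau_of_norm_lt_one h] at h1
  rw [conj_eq_inv_of_pow (by norm_num) (map_gen_ten_pow_coe σ),
    ← pow_pred_eq_inv (by norm_num) (map_gen_ten_pow_coe σ)]
  exact h1.symm

theorem goldenConj_sq : (1 - Real.goldenRatio) ^ 2 = (1 - Real.goldenRatio) + 1 := by
  linear_combination Real.goldenRatio_sq

theorem norm_gen_ten : ‖(gen 10 : ℂ)‖ = 1 :=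
  Complex.norm_eq_one_of_pow_eq_one gen_ten_pow_coe (by norm_num)

theorem norm_map_gen_ten (σ : cyclotomicIntegers 10 ≃+* cyclotomicIntegers 10) :
    ‖(σ (gen 10) : ℂ)‖ = 1 :=
  Complex.norm_eq_one_of_pow_eq_one (map_gen_ten_pow_coe σ) (by norm_num)

theorem exists_ev (σ : cyclotomicIntegers 10 ≃+* cyclotomicIntegers 10)
    (x : cyclotomicIntegers 10) :
    ∃ c : Coords, (x : ℂ) = ev (gen 10) c ∧ (σ x : ℂ) = ev (σ (gen 10)) c := by
  have h4 : gen 10 ^ 4 = ((-1 : ℤ) : cyclotomicIntegers 10) + (1 : ℤ) * gen 10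
      + (-1 : ℤ) * gen 10 ^ 2 + (1 : ℤ) * gen 10 ^ 3 := by
    refine Subtype.ext ?_
    have := pow_four_eq norm_gen_ten gen_ten_add_conj Real.goldenRatio_sq
    simp
    rw [this]; ring
  obtain ⟨c0, c1, c2, c3, hc⟩ := exists_coords h4 x
  refine ⟨(c0, c1, c2, c3), ?_, ?_⟩ <;> rw [hc] <;> simp [ev]

end Ten

/-! ### Finite verifications -/

section Finite

/-- Coordinates of `θ ^ i₀ + τ (θ ^ i₁ + τ (θ ^ i₂ + ⋯))`, for the list `[i₀, i₁, …]`. -/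
def horner : List ℕ → Coords
  | [] => (0, 0, 0, 0)
  | i :: l => add (rot^[i] (1, 0, 0, 0)) (mulTau (horner l))

/-- Up to rotation, the short elements of the spectrum of `τ`. -/
def shortDigits : List (List ℕ) :=
  [[], [0], [1, 6], [8, 5], [8, 0, 5], [8, 6, 8, 3], [2, 4, 2, 7]]

/-- The rational part of `2 Re (x conj y)`. -/
def bilP (c d : Coords) : ℤ := formP c + formP d - formP (sub c d)

/-- The coefficient of `θ + θ⁻¹` in `2 Re (x conj y)`. -/
def bilQ (c d : Coords) : ℤ := formQ c + formQ d - formQ (sub c d)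

/-- Coordinates of `ω⁰ / τ`. -/
def tauInv : Coords := (0, 0, 1, -1)

/-- Coordinates of `(1 - ω²) / τ`. -/
def tauInvDiff : Coords := sub tauInv (rot^[2] tauInv)

/-- The conditions relax |x|² < 2.65 and the ten edge inequalities of the open decagon of radius φ².
Its edge normals are the conjugates of ω^k(1 + ω³), and the bound for 2 Re is φ²(2 + φ) = 3 + 4φ.
Adding k to all exponents rotates an expansion. -/
theorem finite_check_tau : ∀ a b c d : Fin 5,
    let x : Coords := ((a : ℤ) - 2, (b : ℤ) - 2, (c : ℤ) - 2, (d : ℤ) - 2)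
    isNeg (100 * formP x - 265) (100 * formQ x) = true →
    (∀ k : Fin 10, isNeg (bilP x (rot^[k] (1, 0, 0, 1)) + bilQ x (rot^[k] (1, 0, 0, 1)) - 3)
      (-bilQ x (rot^[k] (1, 0, 0, 1)) - 4) = true) →
    ∃ k : Fin 10, ∃ l ∈ shortDigits, x = horner (l.map (· + (k : ℕ))) := by
  decide +kernel

/-- Relaxes |x|² < 0.4 and |σ(x)|² < 2.65. -/
theorem finite_check_tau_sq : ∀ a b c d : Fin 3,
    let x : Coords := ((a : ℤ) - 1, (b : ℤ) - 1, (c : ℤ) - 1, (d : ℤ) - 1)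
    isNeg (100 * formP x - 40) (100 * formQ x) = true →
    isNeg (100 * (formP x + formQ x) - 265) (-100 * formQ x) = true →
    x = (0, 0, 0, 0) ∨ ∃ k : Fin 10, x = rot^[k] tauInv := by
  decide +kernel

/-- Here e is the difference of two remainders and d the difference one digit earlier. The digits u,
v must point to opposite sides along σ(e), and |d|² < 2 is a relaxation of |d|² < 8 - 4φ. -/
theorem finite_check_diff : ∀ i a b : Fin 10,
    let e : Coords := rot^[i] tauInvDiff
    let u : Coords := rot^[a] (1, 0, 0, 0)
    let v : Coords := rot^[b] (1, 0, 0, 0)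
    let d : Coords := add (sub u v) (mulTau (mulTau e))
    isNeg (-(bilP u e + bilQ u e)) (bilQ u e) = true →
    isNeg (bilP v e + bilQ v e) (-bilQ v e) = true →
    isNeg (formP d - 2) (formQ d) = true →
    ∃ k : Fin 10, d = rot^[k] tauInvDiff := by
  decide +kernel

theorem sub_tauInv : ∀ i j : Fin 10, j - i = 2 ∨ j - i = 8 →
    ∃ k : Fin 10, sub (rot^[i] tauInv) (rot^[j] tauInv) = rot^[k] tauInvDiff := by
  decide +kernel

/-- Opposite points are at squared distance exactly 8 - 4φ = (2/τ)², which the strict bound on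
remainders excludes. -/
theorem sub_tauInv_opposite : ∀ i j : Fin 10, j - i = 5 →
    formP (sub (rot^[i] tauInv) (rot^[j] tauInv)) = 8 ∧
      formQ (sub (rot^[i] tauInv) (rot^[j] tauInv)) = -4 := by
  decide +kernel

theorem finite_check_direction : ∀ i j : Fin 10,
    let P := bilP (rot^[j] tauInv) (rot^[i] (1, 0, 0, 0))
    let Q := bilQ (rot^[j] tauInv) (rot^[i] (1, 0, 0, 0))
    isNeg (P + Q) (-Q) = true →
    j - i = 0 ∨ j - i = 3 ∨ j - i = 4 ∨ j - i = 6 ∨ j - i = 7 := by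
  decide +kernel

/-- A set of directions without pairs at distance `2`, `5` or `8` leaves some direction free. -/
theorem false_of_directions {V : Fin 10 → Prop}
    (hV : ∀ i j, V i → V j → ¬ (j - i = 2 ∨ j - i = 5 ∨ j - i = 8))
    (h : ∀ i, ∃ j, V j ∧ (j - i = 0 ∨ j - i = 3 ∨ j - i = 4 ∨ j - i = 6 ∨ j - i = 7)) : False := by
  have consecutive : ∀ i, V i → V (i + 1) → False := by
    -- The witnesses for direction i + 2 are i + 2, 5, 6, 8, 9: the offsets 2, 5, 8 clash with i,
    -- and 6, 9 with i + 1.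
    intro i h0 h1
    obtain ⟨s, hs, hsi⟩ := h (i + 2)
    have key : ∀ i s : Fin 10, (s - (i + 2) = 0 ∨ s - (i + 2) = 3 ∨ s - (i + 2) = 4 ∨
        s - (i + 2) = 6 ∨ s - (i + 2) = 7) → (s - i = 2 ∨ s - i = 5 ∨ s - i = 8) ∨
        (s - (i + 1) = 2 ∨ s - (i + 1) = 5 ∨ s - (i + 1) = 8) := by decide +kernel
    exact (key i s hsi).elim (hV _ _ h0 hs) (hV _ _ h1 hs)
  obtain ⟨j, hj, _⟩ := h 0
  -- The witnesses for j + 5 are j + 5, 8, 9, 1, 2; only j ± 1 do not clash with j, and these are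
  -- consecutive to it.
  obtain ⟨s, hs, hsj⟩ := h (j + 5)
  have key : ∀ j s : Fin 10, (s - (j + 5) = 0 ∨ s - (j + 5) = 3 ∨ s - (j + 5) = 4 ∨
      s - (j + 5) = 6 ∨ s - (j + 5) = 7) → (s - j = 2 ∨ s - j = 5 ∨ s - j = 8) ∨
      s = j + 1 ∨ j = s + 1 := by decide +kernel
  rcases key j s hsj with h1 | rfl | rfl
  · exact hV _ _ hj hs h1
  · exact consecutive _ hj hs
  · exact consecutive _ hs hj

end Finite

/-! ### Geometry of the regular decagon; the attractor for τ -/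

section Decagon

/-- The closed regular decagon of radius `r`. -/
def decagon (r : ℝ) : Set ℂ :=
  convexHull ℝ (Set.range fun k : ℤ => (r : ℂ) * rootOfUnity 10 ^ k)

theorem exists_pow_ten {u : ℂ} (hu : u ^ 10 = 1) : ∃ i : Fin 10, rootOfUnity 10 ^ (i : ℕ) = u := by
  obtain ⟨i, hi, h⟩ := (isPrimitiveRoot_rootOfUnity (n := 10) (by norm_num)).eq_pow_of_pow_eq_one hu
  exact ⟨⟨i, hi⟩, h⟩

theorem vertex_mem_decagon (r : ℝ) {u : ℂ} (hu : u ^ 10 = 1) : r * u ∈ decagon r := by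
  obtain ⟨i, rfl⟩ := exists_pow_ten hu
  exact subset_convexHull _ _ ⟨(i : ℕ), by simp⟩

theorem convex_decagon (r : ℝ) : Convex ℝ (decagon r) := convex_convexHull _ _

theorem decagon_subset {r : ℝ} {s : Set ℂ} (hs : Convex ℝ s)
    (h : ∀ u : ℂ, u ^ 10 = 1 → (r : ℂ) * u ∈ s) : decagon r ⊆ s := by
  refine convexHull_min ?_ hs
  rintro _ ⟨k, rfl⟩
  exact h _ (zpow_rootOfUnity_pow (by norm_num) k)

theorem real_mul_mem_decagon (c : ℝ) {r : ℝ} {z : ℂ} (hz : z ∈ decagon r) :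
    (c : ℂ) * z ∈ decagon (c * r) := by
  have h : decagon r ⊆ {z : ℂ | (c : ℂ) * z ∈ decagon (c * r)} := by
    refine decagon_subset ?_ fun u hu => ?_
    · have := (convex_decagon (c * r)).linear_preimage (LinearMap.mulLeft ℝ (c : ℂ))
      exact this
    · have := vertex_mem_decagon (c * r) hu
      push_cast at this
      rwa [mul_assoc] at this
  exact h hz

theorem neg_mem_decagon {r : ℝ} {z : ℂ} (hz : z ∈ decagon r) : -z ∈ decagon r := by
  have h : decagon r ⊆ {z : ℂ | -z ∈ decagon r} := by
    refine decagon_subset ?_ fun u hu => ?_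
    · have := (convex_decagon r).linear_preimage (-LinearMap.id : ℂ →ₗ[ℝ] ℂ)
      exact this
    · have := vertex_mem_decagon r (u := -u) (by rw [Even.neg_pow (by decide), hu])
      rwa [mul_neg] at this
  exact h hz

theorem zero_mem_decagon (r : ℝ) : (0 : ℂ) ∈ decagon r := by
  have h := vertex_mem_decagon r (u := 1) (by norm_num)
  have := convex_decagon r h (neg_mem_decagon h) (a := 1 / 2) (b := 1 / 2) (by norm_num)
    (by norm_num) (by norm_num)
  simpa using this

theorem add_mem_decagon {r p q : ℝ} (hp : 0 ≤ p) (hq : 0 ≤ q) (hpq : p + q ≤ 1) {x y : ℂ}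
    (hx : x ∈ decagon r) (hy : y ∈ decagon r) : (p : ℂ) * x + (q : ℂ) * y ∈ decagon r := by
  have hc := convex_decagon r
  rcases eq_or_lt_of_le (show p ≤ 1 by linarith) with rfl | h1
  · obtain rfl : q = 0 := by linarith
    simpa using hx
  · have h2 : (q / (1 - p)) • y ∈ decagon r := by
      refine hc.smul_mem_of_zero_mem (zero_mem_decagon r) hy ⟨by
        have : 0 < 1 - p := by linarith
        positivity, ?_⟩
      rw [div_le_one (by linarith)]; linarith
    have h3 := hc hx h2 hp (by linarith : 0 ≤ 1 - p) (by ring)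
    have h4 : (1 - p) • (q / (1 - p)) • y = q • y := by
      rw [smul_smul]; congr 1
      have : 1 - p ≠ 0 := by linarith
      field_simp
    rw [h4] at h3
    simpa using h3

/-- The points ±ru and ±rv are vertices, and 0 absorbs the slack in the weights. -/
theorem combo_mem_decagon {r p q : ℝ} (hr : 0 < r) (hpq : |p| + |q| ≤ r) {u v : ℂ}
    (hu : u ^ 10 = 1) (hv : v ^ 10 = 1) : (p : ℂ) * u + q * v ∈ decagon r := by
  have key : ∀ (c : ℝ) {w : ℂ}, w ^ 10 = 1 →
      ∃ x ∈ decagon r, ((|c| / r : ℝ) : ℂ) * x = c * w := by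
    intro c w hw
    have hr' : (r : ℂ) ≠ 0 := by exact_mod_cast hr.ne'
    have hv := vertex_mem_decagon r hw
    rcases le_total 0 c with hc | hc
    · refine ⟨_, hv, ?_⟩
      rw [abs_of_nonneg hc]; push_cast; field_simp
    · refine ⟨_, neg_mem_decagon hv, ?_⟩
      rw [abs_of_nonpos hc]; push_cast; field_simp
  obtain ⟨x, hx, hxe⟩ := key p hu
  obtain ⟨y, hy, hye⟩ := key q hv
  rw [← hxe, ← hye]
  refine add_mem_decagon (by positivity) (by positivity) ?_ hx hy
  rw [← add_div, div_le_one hr]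
  exact hpq

theorem norm_le_of_mem_decagon {r : ℝ} (hr : 0 ≤ r) {z : ℂ} (hz : z ∈ decagon r) : ‖z‖ ≤ r := by
  have h : decagon r ⊆ Metric.closedBall 0 r := by
    refine decagon_subset (convex_closedBall _ _) fun u hu => ?_
    rw [mem_closedBall_zero_iff, norm_mul, Complex.norm_eq_one_of_pow_eq_one hu (by norm_num)]
    simp [abs_of_nonneg hr]
  exact mem_closedBall_zero_iff.1 (h hz)

theorem isClosed_decagon (r : ℝ) : IsClosed (decagon r) := by
  refine (Set.Finite.isCompact_convexHull ℝ ?_).isClosed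
  refine (Set.finite_range fun i : Fin 10 => (r : ℂ) * rootOfUnity 10 ^ (i : ℕ)).subset ?_
  rintro _ ⟨k, rfl⟩
  obtain ⟨i, hi⟩ := exists_pow_ten (zpow_rootOfUnity_pow (n := 10) (by norm_num) k)
  exact ⟨i, by simp only [hi]⟩

/-- Two tenth roots of unity at angle `π / 5` from each other. -/
def Adjacent (u v : ℂ) : Prop :=
  u ^ 10 = 1 ∧ v ^ 10 = 1 ∧ 2 * (u * conj v).re = Real.goldenRatio

/-- Take u nearest in direction and v the neighbour on the side of z; the sine rule gives the
coefficients, and t ≤ s since the angle to u is at most π/10. -/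
theorem exists_sector (z : ℂ) : ∃ u v : ℂ, Adjacent u v ∧ ∃ s t : ℝ, 0 ≤ t ∧ t ≤ s ∧
    z = s * u + t * v := by
  obtain ⟨j, φ, hφ, hz⟩ := exists_rotation (n := 10) (by norm_num) z
  have hpi := Real.pi_pos
  have hω := zpow_rootOfUnity_pow (n := 10) (by norm_num) j
  have hωn := Complex.norm_eq_one_of_pow_eq_one hω (by norm_num)
  set u := rootOfUnity 10 ^ j
  have huu : u * conj u = 1 := by rw [Complex.mul_conj, Complex.normSq_eq_norm_sq, hωn]; simp
  have hsin : 0 < Real.sin (Real.pi / 5) :=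
    Real.sin_pos_of_pos_of_lt_pi (by positivity) (by linarith)
  push_cast at hφ
  have adj : ∀ ε : ℝ, ε = 1 ∨ ε = -1 →
      Adjacent u (u * Complex.exp ((ε * (Real.pi / 5) : ℝ) * I)) := by
    intro ε hε
    refine ⟨hω, ?_, ?_⟩
    · rw [mul_pow, hω, one_mul, ← Complex.exp_nat_mul]
      rcases hε with rfl | rfl
      · rw [Complex.exp_eq_one_iff]; exact ⟨1, by push_cast; ring⟩
      · rw [Complex.exp_eq_one_iff]; exact ⟨-1, by push_cast; ring⟩
    · rw [map_mul, ← mul_assoc, huu, one_mul, Complex.conj_re, Complex.exp_ofReal_mul_I_re]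
      have : Real.cos (ε * (Real.pi / 5)) = Real.cos (Real.pi / 5) := by
        rcases hε with rfl | rfl <;> simp
      rw [this, Real.cos_pi_div_five, Real.goldenRatio]; ring
  have main : ∀ ε ψ : ℝ, (ε = 1 ∨ ε = -1) → 0 ≤ ψ → ψ ≤ Real.pi / 10 → φ = ε * ψ →
      ∃ u v : ℂ, Adjacent u v ∧ ∃ s t : ℝ, 0 ≤ t ∧ t ≤ s ∧ z = s * u + t * v := by
    intro ε ψ hε h0 h1 hφψ
    refine ⟨_, _, adj ε hε, ‖z‖ * Real.sin (Real.pi / 5 - ψ) / Real.sin (Real.pi / 5),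
      ‖z‖ * Real.sin ψ / Real.sin (Real.pi / 5), ?_, ?_, ?_⟩
    · have := Real.sin_nonneg_of_nonneg_of_le_pi h0 (by linarith)
      positivity
    · have := Real.sin_le_sin_of_le_of_le_pi_div_two (x := ψ) (y := Real.pi / 5 - ψ)
        (by linarith) (by linarith) (by linarith)
      gcongr
    · have key : Complex.exp (φ * I) = ((Real.sin (Real.pi / 5 - ψ) / Real.sin (Real.pi / 5) : ℝ) : ℂ)
          + ((Real.sin ψ / Real.sin (Real.pi / 5) : ℝ) : ℂ)
            * Complex.exp ((ε * (Real.pi / 5) : ℝ) * I) := by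
        apply Complex.ext
        · simp only [Complex.add_re, Complex.re_ofReal_mul, Complex.exp_ofReal_mul_I_re,
            Complex.ofReal_re]
          have e1 : Real.cos φ = Real.cos ψ := by rw [hφψ]; rcases hε with rfl | rfl <;> simp
          have e2 : Real.cos (ε * (Real.pi / 5)) = Real.cos (Real.pi / 5) := by
            rcases hε with rfl | rfl <;> simp
          rw [e1, e2, Real.sin_sub]
          field_simp
          ring
        · simp only [Complex.add_im, Complex.im_ofReal_mul, Complex.exp_ofReal_mul_I_im,
            Complex.ofReal_im]
          have e1 : Real.sin φ = ε * Real.sin ψ := by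
            rw [hφψ]; rcases hε with rfl | rfl <;> simp
          have e2 : Real.sin (ε * (Real.pi / 5)) = ε * Real.sin (Real.pi / 5) := by
            rcases hε with rfl | rfl <;> simp
          rw [e1, e2]
          field_simp
          ring
      conv_lhs => rw [hz, key]
      push_cast
      ring
  rcases le_total 0 φ with h | h
  · exact main 1 φ (Or.inl rfl) h ((abs_le.1 hφ).2) (by ring)
  · exact main (-1) (-φ) (Or.inr rfl) (by linarith) (by linarith [(abs_le.1 hφ).1]) (by ring)

theorem finite_check_adjacent : ∀ k : Fin 10,
    1000 * (bilP (rot^[k] (1, 0, 0, 0)) (1, 1, 0, 0) - 2)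
      + 1618 * (bilQ (rot^[k] (1, 0, 0, 0)) (1, 1, 0, 0) - 1) ≤ 0 ∧
    10000 * (bilP (rot^[k] (1, 0, 0, 0)) (1, 1, 0, 0) - 2)
      + 16181 * (bilQ (rot^[k] (1, 0, 0, 0)) (1, 1, 0, 0) - 1) ≤ 0 := by
  decide +kernel

theorem isPrimitiveRoot_of_add_conj {ζ : ℂ} (hζ : ‖ζ‖ = 1) (ht : ζ + conj ζ = Real.goldenRatio) :
    IsPrimitiveRoot ζ 10 := by
  have h1 := sq_eq_of_add_conj hζ ht
  have hω := norm_gen_ten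
  have h2 : (gen 10 : ℂ) * conj (gen 10 : ℂ) = 1 := by
    rw [Complex.mul_conj, Complex.normSq_eq_norm_sq, hω]; simp
  have hp : IsPrimitiveRoot (gen 10 : ℂ) 10 := isPrimitiveRoot_rootOfUnity (by norm_num)
  have h3 : (ζ - gen 10) * (ζ - conj (gen 10 : ℂ)) = 0 := by
    linear_combination h1 + h2 - ζ * gen_ten_add_conj
  rcases mul_eq_zero.1 h3 with h | h
  · rw [sub_eq_zero.1 h]; exact hp
  · rw [sub_eq_zero.1 h, conj_eq_inv_of_pow (by norm_num) gen_ten_pow_coe]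
    exact hp.inv

/-- The vector u + v is normal to the edge between u and v, where equality holds. After rotating u
to 1, the ten values P + Qφ are compared with 2 + φ at rational bounds for φ. -/
theorem Adjacent.re_le {u v : ℂ} (huv : Adjacent u v) {a : ℂ} (ha : a ^ 10 = 1) :
    2 * (a * conj (u + v)).re ≤ 2 + Real.goldenRatio := by
  obtain ⟨hu, hv, h⟩ := huv
  have hun := Complex.norm_eq_one_of_pow_eq_one hu (by norm_num)
  have hvn := Complex.norm_eq_one_of_pow_eq_one hv (by norm_num)
  have huu : u * conj u = 1 := by rw [Complex.mul_conj, Complex.normSq_eq_norm_sq, hun]; simp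
  set ζ := v * conj u with hζ
  have hζn : ‖ζ‖ = 1 := by rw [hζ, norm_mul, hvn, RCLike.norm_conj, hun, one_mul]
  have ht : ζ + conj ζ = Real.goldenRatio := by
    rw [Complex.add_conj, ← h, hζ]
    congr 2
    simp [Complex.mul_re]
    ring
  have hb : (a * conj u) ^ 10 = 1 := by rw [mul_pow, ha, ← map_pow, hu]; simp
  obtain ⟨i, hi, hbi⟩ := (isPrimitiveRoot_of_add_conj hζn ht).eq_pow_of_pow_eq_one hb
  have e1 : ev ζ (rot^[i] (1, 0, 0, 0)) = a * conj u := by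
    rw [ev_rot_iterate hζn ht Real.goldenRatio_sq, ev_one, mul_one, hbi]
  have e2 : a * conj (u + v) = ev ζ (rot^[i] (1, 0, 0, 0)) * conj (ev ζ (1, 1, 0, 0)) := by
    have : ev ζ (1, 1, 0, 0) = 1 + ζ := by simp [ev]
    rw [e1, this, hζ]
    simp only [map_add, map_mul, map_one, Complex.conj_conj]
    linear_combination (-a * conj v) * huu
  rw [e2, two_re_ev hζn ht Real.goldenRatio_sq]
  obtain ⟨c1, c2⟩ := finite_check_adjacent ⟨i, hi⟩
  change 1000 * (bilP (rot^[i] (1, 0, 0, 0)) (1, 1, 0, 0) - 2)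
      + 1618 * (bilQ (rot^[i] (1, 0, 0, 0)) (1, 1, 0, 0) - 1) ≤ 0 at c1
  change 10000 * (bilP (rot^[i] (1, 0, 0, 0)) (1, 1, 0, 0) - 2)
      + 16181 * (bilQ (rot^[i] (1, 0, 0, 0)) (1, 1, 0, 0) - 1) ≤ 0 at c2
  change (bilP (rot^[i] (1, 0, 0, 0)) (1, 1, 0, 0) : ℝ)
      + bilQ (rot^[i] (1, 0, 0, 0)) (1, 1, 0, 0) * Real.goldenRatio ≤ _
  generalize bilP (rot^[i] (1, 0, 0, 0)) (1, 1, 0, 0) = P at *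
  generalize bilQ (rot^[i] (1, 0, 0, 0)) (1, 1, 0, 0) = Q at *
  have c1' : (1000 * (P - 2) + 1618 * (Q - 1) : ℝ) ≤ 0 := by exact_mod_cast c1
  have c2' : (10000 * (P - 2) + 16181 * (Q - 1) : ℝ) ≤ 0 := by exact_mod_cast c2
  obtain ⟨g1, g2⟩ := goldenRatio_bounds
  rcases le_total (Q : ℝ) 1 with hQ | hQ <;> nlinarith

theorem Adjacent.re_le_of_mem_decagon {u v : ℂ} (huv : Adjacent u v) {r : ℝ} (hr : 0 ≤ r) {z : ℂ}
    (hz : z ∈ decagon r) : 2 * (z * conj (u + v)).re ≤ r * (2 + Real.goldenRatio) := by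
  have h : decagon r ⊆ {z : ℂ | 2 * (z * conj (u + v)).re ≤ r * (2 + Real.goldenRatio)} := by
    refine decagon_subset ?_ fun a ha => ?_
    · refine convex_halfSpace_le (f := fun z : ℂ => 2 * (z * conj (u + v)).re) ⟨?_, ?_⟩ _
      · intro x y; rw [add_mul, Complex.add_re]; ring
      · intro c x; rw [Complex.real_smul, mul_assoc, Complex.re_ofReal_mul, smul_eq_mul]; ring
    · have := huv.re_le ha
      change 2 * (_ * conj (u + v)).re ≤ _
      rw [mul_assoc, Complex.re_ofReal_mul]
      nlinarith
  exact h hz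

theorem Adjacent.two_re_combo {u v : ℂ} (huv : Adjacent u v) (s t : ℝ) :
    2 * ((s * u + t * v) * conj (u + v)).re = (s + t) * (2 + Real.goldenRatio) := by
  obtain ⟨hu, hv, h⟩ := huv
  have hun := Complex.norm_eq_one_of_pow_eq_one hu (by norm_num)
  have hvn := Complex.norm_eq_one_of_pow_eq_one hv (by norm_num)
  have huu : u * conj u = 1 := by rw [Complex.mul_conj, Complex.normSq_eq_norm_sq, hun]; simp
  have hvv : v * conj v = 1 := by rw [Complex.mul_conj, Complex.normSq_eq_norm_sq, hvn]; simp
  have hvu : (v * conj u).re = (u * conj v).re := by simp [Complex.mul_re]; ring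
  have e : (s * u + t * v) * conj (u + v)
      = s * (u * conj u) + s * (u * conj v) + t * (v * conj u) + t * (v * conj v) := by
    rw [map_add]; ring
  rw [e, huu, hvv]
  simp only [Complex.add_re, Complex.re_ofReal_mul, hvu, Complex.one_re]
  linear_combination (s + t) * h

/-- The self-covering property of the decagon of radius `φ²`, with control of the radius. -/
theorem decagon_step {γ : ℂ} (hγ : γ = ((1 - Real.goldenRatio : ℝ) : ℂ)) {r : ℝ} (hr : 0 ≤ r)
    {z : ℂ} (hz : z ∈ decagon r) : ∃ a ∈ alphabet 10, ∃ z',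
      z' ∈ decagon (Real.goldenRatio * max (r - 1) 1) ∧ z = a + γ * z' := by
  obtain ⟨u, v, huv, s, t, ht, hts, rfl⟩ := exists_sector z
  have h1 := huv.re_le_of_mem_decagon hr hz
  rw [huv.two_re_combo] at h1
  have hg := Real.one_lt_goldenRatio
  have hst : s + t ≤ r := le_of_mul_le_mul_right h1 (by linarith)
  -- Since 1/γ = -φ, removing u leaves -φ((s - 1)u + tv). Its decagonal size is at most φ(|s - 1| +
  -- t), which is at most φ(r - 1) if s ≥ 1 and at most φ otherwise.
  refine ⟨u, (mem_alphabet_iff (by norm_num)).2 (Or.inr huv.1),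
    ((-Real.goldenRatio * (s - 1) : ℝ) : ℂ) * u + ((-Real.goldenRatio * t : ℝ) : ℂ) * v, ?_, ?_⟩
  · refine combo_mem_decagon (by positivity) ?_ huv.1 huv.2.1
    rw [abs_mul, abs_mul, ← mul_add, abs_neg, abs_of_pos (by linarith : 0 < Real.goldenRatio),
      abs_of_nonneg ht]
    refine mul_le_mul_of_nonneg_left ?_ (by linarith)
    rcases le_total 1 s with hs | hs
    · rw [abs_of_nonneg (by linarith)]
      exact le_max_of_le_left (by linarith)
    · rw [abs_of_nonpos (by linarith)]
      exact le_max_of_le_right (by linarith)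
  · have h2 : (Real.goldenRatio : ℂ) ^ 2 = Real.goldenRatio + 1 := by
      exact_mod_cast congrArg (fun x : ℝ => (x : ℂ)) Real.goldenRatio_sq
    rw [hγ, Complex.ofReal_sub]
    simp only [Complex.ofReal_mul, Complex.ofReal_neg, Complex.ofReal_sub, Complex.ofReal_one]
    linear_combination (-(s - 1) * u - t * v) * h2

theorem attractor_eq_decagon {γ : ℂ} (hγ : γ = ((1 - Real.goldenRatio : ℝ) : ℂ)) :
    attractor γ (alphabet 10) = decagon (Real.goldenRatio ^ 2) := by
  have hg := Real.one_lt_goldenRatio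
  have hg2 := Real.goldenRatio_sq
  have hlt : ‖γ‖ < 1 := by
    rw [hγ, Complex.norm_real, Real.norm_eq_abs, abs_lt]
    constructor <;> linarith [Real.goldenRatio_lt_two]
  refine subset_antisymm ?_ ?_
  · rintro z ⟨a, ha, hs⟩
    refine (isClosed_decagon _).mem_of_tendsto hs.tendsto_sum_nat (Filter.Eventually.of_forall ?_)
    intro N
    have h2 : ∀ N (a : ℕ → ℂ), (∀ i, a i ∈ alphabet 10) →
        ∑ i ∈ Finset.range N, a i * γ ^ i ∈ decagon (Real.goldenRatio ^ 2) := by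
      intro N
      induction N with
      | zero => intro a _; simpa using zero_mem_decagon _
      | succ N ih =>
        intro a ha
        have h3 := ih (fun i => a (i + 1)) fun i => ha _
        have h4 : ((Real.goldenRatio ^ 2 : ℝ) : ℂ) * a 0 ∈ decagon (Real.goldenRatio ^ 2) := by
          rcases (mem_alphabet_iff (by norm_num)).1 (ha 0) with h | h
          · rw [h, mul_zero]; exact zero_mem_decagon _
          · exact vertex_mem_decagon _ h
        -- The decagon is convex and symmetric: a + γz = (2 - φ)(φ²a) + (φ - 1)(-z), with weights of
        -- sum 1.
        have h5 := add_mem_decagon (p := 2 - Real.goldenRatio) (q := Real.goldenRatio - 1)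
          (by linarith [Real.goldenRatio_lt_two]) (by linarith) (by linarith) h4
          (neg_mem_decagon h3)
        convert h5 using 1
        rw [Finset.sum_range_succ', add_comm]
        congr 1
        · have : (2 - Real.goldenRatio) * Real.goldenRatio ^ 2 = 1 := by
            rw [hg2]; linear_combination -hg2
          rw [← mul_assoc, ← Complex.ofReal_mul, this]; simp
        · rw [mul_neg, ← neg_mul, ← Complex.ofReal_neg, neg_sub, ← hγ, Finset.mul_sum]
          refine Finset.sum_congr rfl fun i _ => ?_
          rw [pow_succ]; ring
    exact h2 N a ha
  · refine subset_attractor_of_step (fun _ => norm_le_one_of_mem_alphabet (by norm_num)) hlt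
      (fun z hz => norm_le_of_mem_decagon (by positivity) hz) fun z hz => ?_
    obtain ⟨a, ha, z', hz', h⟩ := decagon_step hγ (by positivity) hz
    refine ⟨a, ha, z', ?_, h⟩
    have : Real.goldenRatio * max (Real.goldenRatio ^ 2 - 1) 1 = Real.goldenRatio ^ 2 := by
      rw [max_eq_left (by linarith), hg2]; linear_combination hg2
    rwa [this] at hz'

/-- A slightly enlarged multiple of an interior point is still in the decagon; scale back. -/
theorem exists_lt_of_mem_interior_decagon {r : ℝ} (hr : 0 < r) {z : ℂ}
    (hz : z ∈ interior (decagon r)) : ∃ r', 0 ≤ r' ∧ r' < r ∧ z ∈ decagon r' := by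
  have hcont : Filter.Tendsto (fun c : ℝ => (c : ℂ) * z) (nhds 1) (nhds z) := by
    have : Continuous fun c : ℝ => (c : ℂ) * z := by fun_prop
    simpa using this.tendsto 1
  have hev := hcont.eventually (mem_interior_iff_mem_nhds.1 hz)
  obtain ⟨ε, hε, hball⟩ := Metric.eventually_nhds_iff.1 hev
  have h1 : ((1 + ε / 2 : ℝ) : ℂ) * z ∈ decagon r := by
    refine hball ?_
    rw [Real.dist_eq, add_sub_cancel_left, abs_of_pos (by positivity)]; linarith
  refine ⟨(1 + ε / 2)⁻¹ * r, by positivity, ?_, ?_⟩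
  · rw [inv_mul_lt_iff₀ (by positivity)]; nlinarith
  · have h2 := real_mul_mem_decagon (1 + ε / 2)⁻¹ h1
    rwa [← mul_assoc, ← Complex.ofReal_mul, inv_mul_cancel₀ (by positivity), Complex.ofReal_one,
      one_mul] at h2

end Decagon

/-! ### Order 10 and β = τ -/

section Tau

variable {σ : cyclotomicIntegers 10 ≃+* cyclotomicIntegers 10}

theorem coe_tau : (tau : ℂ) = Real.goldenRatio := rfl

theorem tau_mul_inv : tau * (tau - 1) = 1 := by linear_combination tau_sq

theorem map_tau_ne_zero (σ : cyclotomicIntegers 10 ≃+* cyclotomicIntegers 10) :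
    (σ tau : ℂ) ≠ 0 := by
  have h : (σ tau : ℂ) * σ (tau - 1) = 1 := by
    rw [← MulMemClass.coe_mul, ← map_mul, tau_mul_inv]; simp
  exact left_ne_zero_of_mul_eq_one h

theorem norm_map_tau (h : ‖(σ tau : ℂ)‖ < 1) : ‖(σ tau : ℂ)‖ = Real.goldenRatio - 1 := by
  rw [map_tau_of_norm_lt_one h, Complex.norm_real, Real.norm_eq_abs, abs_of_neg] <;>
    linarith [Real.one_lt_goldenRatio]

theorem cos_pi_div_ten_pos : 0 < Real.cos (Real.pi / (10 : ℕ)) := by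
  refine Real.cos_pos_of_mem_Ioo ⟨?_, ?_⟩ <;> push_cast <;> linarith [Real.pi_pos]

theorem cos_pi_div_ten_sq : 4 * Real.cos (Real.pi / (10 : ℕ)) ^ 2 = 2 + Real.goldenRatio := by
  rw [Real.cos_sq, show 2 * (Real.pi / (10 : ℕ)) = Real.pi / 5 by push_cast; ring,
    Real.cos_pi_div_five, Real.goldenRatio]
  ring

theorem ev_gen_horner_mem (l : List ℕ) :
    ev (gen 10) (horner l) ∈ digitSpectrum (alphabet 10) tau := by
  induction l with
  | nil => simpa [horner, ev] using zero_mem_digitSpectrum (zero_mem_alphabet 10) _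
  | cons i l ih =>
    rw [horner, ev_add, ev_mulTau norm_gen_ten gen_ten_add_conj Real.goldenRatio_sq,
      ev_rot_iterate norm_gen_ten gen_ten_add_conj Real.goldenRatio_sq, ev_one, mul_one]
    refine step_mem_digitSpectrum ?_ ih
    refine (mem_alphabet_iff (by norm_num)).2 (Or.inr ?_)
    rw [← pow_mul, mul_comm, pow_mul, gen_ten_pow_coe, one_pow]

theorem exists_fin_of_sq_le {z : ℤ} {m : ℕ} (h : z ^ 2 < (m + 1) ^ 2) :
    ∃ a : Fin (2 * m + 1), z = (a : ℤ) - m := by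
  have h1 := abs_lt_of_sq_lt_sq' h (by positivity)
  refine ⟨⟨(z + m).toNat, ?_⟩, ?_⟩
  · have := h1.1; have := h1.2; omega
  · have := h1.1
    simp only
    rw [Int.toNat_of_nonneg (by omega)]; ring

theorem exists_fin_coords {c : Coords} {m : ℕ} (h : 4 * (2 * formP c + formQ c) < 5 * (m + 1) ^ 2) :
    ∃ x y z w : Fin (2 * m + 1), c = ((x : ℤ) - m, (y : ℤ) - m, (z : ℤ) - m, (w : ℤ) - m) := by
  obtain ⟨h0, h1, h2, h3⟩ := sq_coords_le c
  obtain ⟨x, hx⟩ := exists_fin_of_sq_le (z := c.1) (m := m) (by linarith)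
  obtain ⟨y, hy⟩ := exists_fin_of_sq_le (z := c.2.1) (m := m) (by linarith)
  obtain ⟨z, hz⟩ := exists_fin_of_sq_le (z := c.2.2.1) (m := m) (by linarith)
  obtain ⟨w, hw⟩ := exists_fin_of_sq_le (z := c.2.2.2) (m := m) (by linarith)
  exact ⟨x, y, z, w, by rw [← hx, ← hy, ← hz, ← hw]⟩

theorem norm_sq_coe_ev (c : Coords) :
    ‖ev (gen 10) c‖ ^ 2 = formP c + formQ c * Real.goldenRatio :=
  norm_sq_ev norm_gen_ten gen_ten_add_conj Real.goldenRatio_sq c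

theorem norm_sq_map_ev (h : ‖(σ tau : ℂ)‖ < 1) (c : Coords) :
    ‖ev (σ (gen 10)) c‖ ^ 2 = formP c + formQ c * (1 - Real.goldenRatio) :=
  norm_sq_ev (norm_map_gen_ten σ) (map_gen_ten_add_conj h) goldenConj_sq c

theorem trace_lt_of_norm_sq_le (h : ‖(σ tau : ℂ)‖ < 1) {c : Coords} {b : ℤ}
    (hb : ‖ev (gen 10) c‖ ^ 2 + ‖ev (σ (gen 10)) c‖ ^ 2 < b) : 2 * formP c + formQ c < b := by
  rw [norm_sq_coe_ev, norm_sq_map_ev h] at hb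
  have : (2 * formP c + formQ c : ℝ) < b := by linarith
  exact_mod_cast this

/-- The conjugate of ω is at angle ±3π/5, so its cube is at angle ∓π/5. -/
theorem adjacent_map_gen (h : ‖(σ tau : ℂ)‖ < 1) (k : ℕ) :
    Adjacent ((σ (gen 10) : ℂ) ^ k) ((σ (gen 10) : ℂ) ^ (k + 3)) := by
  have hp := map_gen_ten_pow_coe σ
  refine ⟨by rw [← pow_mul, mul_comm, pow_mul, hp, one_pow],
    by rw [← pow_mul, mul_comm, pow_mul, hp, one_pow], ?_⟩
  set θ : ℂ := ((σ (gen 10) : cyclotomicIntegers 10) : ℂ)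
  have hθ : ‖θ‖ = 1 := norm_map_gen_ten σ
  have hθθ : θ * conj θ = 1 := by rw [Complex.mul_conj, Complex.normSq_eq_norm_sq, hθ]; simp
  have ht := map_gen_ten_add_conj h
  have h2 : (Real.goldenRatio : ℂ) ^ 2 = Real.goldenRatio + 1 := by
    exact_mod_cast congrArg (fun x : ℝ => (x : ℂ)) Real.goldenRatio_sq
  have e1 : θ ^ k * conj (θ ^ (k + 3)) = conj θ ^ 3 := by
    rw [map_pow, pow_add, ← mul_assoc, ← mul_pow, hθθ, one_pow, one_mul]
  have e2 : ((2 * (conj θ ^ 3).re : ℝ) : ℂ) = θ ^ 3 + conj θ ^ 3 := by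
    rw [← Complex.add_conj, map_pow, Complex.conj_conj]; ring
  rw [e1]
  refine Complex.ofReal_injective ?_
  rw [e2]
  change θ + conj θ = _ at ht
  rw [Complex.ofReal_sub, Complex.ofReal_one] at ht
  generalize conj θ = η at *
  obtain rfl : η = 1 - Real.goldenRatio - θ := by linear_combination ht
  generalize (Real.goldenRatio : ℂ) = g at *
  linear_combination (-3 * (1 - g)) * hθθ + (2 - g) * h2

theorem zero_mem_interior_attractor_tau (h : ‖(σ tau : ℂ)‖ < 1) :
    (0 : ℂ) ∈ interior (attractor (σ tau) (alphabet 10)) := by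
  have hc := cos_pi_div_ten_pos
  have hc2 := cos_pi_div_ten_sq
  obtain ⟨g1, g2⟩ := goldenRatio_bounds
  set c := Real.cos (Real.pi / (10 : ℕ)) with hcdef
  have c1 : 0.95 < c := by nlinarith
  refine zero_mem_interior_attractor (by norm_num) (map_tau_ne_zero σ) h (r := 1) (by norm_num)
    ?_ ?_
  · rw [norm_map_tau h, ← hcdef]; nlinarith
  · rw [norm_map_tau h, ← hcdef]; nlinarith

theorem mem_digitSpectrum_tau_of_small (h : ‖(σ tau : ℂ)‖ < 1) {r : ℝ} (hr0 : 0 ≤ r)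
    (hr : r < Real.goldenRatio ^ 2) {x : cyclotomicIntegers 10}
    (hσx : (σ x : ℂ) ∈ decagon r) (hx : ‖(x : ℂ)‖ ^ 2 < 2.65) :
    (x : ℂ) ∈ digitSpectrum (alphabet 10) tau := by
  obtain ⟨c, hc, hσc⟩ := exists_ev σ x
  obtain ⟨g1, g2⟩ := goldenRatio_bounds
  have hg := Real.goldenRatio_sq
  have hn := norm_le_of_mem_decagon hr0 hσx
  have htr : 2 * formP c + formQ c < 10 := by
    refine trace_lt_of_norm_sq_le h ?_
    rw [← hc, ← hσc]
    have : ‖(σ x : ℂ)‖ ^ 2 < (2.63 : ℝ) ^ 2 := by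
      refine pow_lt_pow_left₀ ?_ (norm_nonneg _) (by norm_num)
      linarith
    push_cast
    linarith
  obtain ⟨a0, a1, a2, a3, ha⟩ := exists_fin_coords (c := c) (m := 2) (by push_cast; linarith)
  have key := finite_check_tau a0 a1 a2 a3
  simp only [Nat.cast_ofNat] at ha
  rw [← ha] at key
  suffices H : _ ∧ _ by
    obtain ⟨k, l, _, hkl⟩ := key H.1 H.2
    rw [hc, hkl]
    exact ev_gen_horner_mem _
  refine ⟨?_, ?_⟩
  · have := isNeg_of_lt_div (p := formP c) (q := formQ c) (m := 100) (b := 265) (by norm_num) (by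
      rw [← norm_sq_coe_ev, ← hc]; push_cast; linarith)
    exact_mod_cast this
  · intro k
    refine isNeg_of_lt ?_
    have hadj := adjacent_map_gen h k
    have h1 := hadj.re_le_of_mem_decagon hr0 hσx
    have e : (σ (gen 10) : ℂ) ^ (k : ℕ) + (σ (gen 10) : ℂ) ^ ((k : ℕ) + 3)
        = ev (σ (gen 10)) (rot^[k] (1, 0, 0, 1)) := by
      rw [ev_rot_iterate (norm_map_gen_ten σ) (map_gen_ten_add_conj h) goldenConj_sq]
      simp [ev]
      ring
    rw [e, hσc, two_re_ev (norm_map_gen_ten σ) (map_gen_ten_add_conj h) goldenConj_sq] at h1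
    change (bilP c (rot^[k] (1, 0, 0, 1)) : ℝ)
      + bilQ c (rot^[k] (1, 0, 0, 1)) * (1 - Real.goldenRatio) ≤ _ at h1
    have h2 : r * (2 + Real.goldenRatio) < Real.goldenRatio ^ 2 * (2 + Real.goldenRatio) :=
      mul_lt_mul_of_pos_right hr (by linarith)
    push_cast
    nlinarith

theorem tau_part (h : ‖(σ tau : ℂ)‖ < 1) :
    IsWindow (openPolygon 10 (Real.goldenRatio ^ 2)) ∧
      interior (attractor (σ tau) (alphabet 10)) = openPolygon 10 (Real.goldenRatio ^ 2) ∧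
      digitSpectrum (alphabet 10) tau = cutProject σ (openPolygon 10 (Real.goldenRatio ^ 2)) := by
  have hval := map_tau_of_norm_lt_one h
  obtain ⟨g1, g2⟩ := goldenRatio_bounds
  have hg := Real.goldenRatio_sq
  have hint : interior (attractor (σ tau) (alphabet 10)) =
      openPolygon 10 (Real.goldenRatio ^ 2) := by
    rw [attractor_eq_decagon hval]; rfl
  have hpoly : openPolygon 10 (Real.goldenRatio ^ 2)
      = interior (decagon (Real.goldenRatio ^ 2)) := rfl
  have h0 := zero_mem_interior_attractor_tau h
  have hτ : tau ≠ 0 := by rintro ht; apply map_tau_ne_zero σ; rw [ht]; simp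
  refine ⟨hint ▸ (isWindow_attractor (by norm_num) h h0).1, hint, subset_antisymm ?_ ?_⟩
  · rw [← hint]
    exact digitSpectrum_subset_cutProject (by norm_num) σ hτ h0
  · rintro _ ⟨x, rfl, hx⟩
    rw [hpoly] at hx
    refine mem_digitSpectrum_of_descent (b := Real.goldenRatio) (by norm_num) coe_tau
      Real.one_lt_goldenRatio
      -- The radius varies to stay in the open decagon: φ max(r - 1, 1) < φ² whenever r < φ².
      (S := {x | ∃ r, 0 ≤ r ∧ r < Real.goldenRatio ^ 2 ∧ (σ x : ℂ) ∈ decagon r}) ?_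
      (ε := 0.001) (by norm_num) ?_ (exists_lt_of_mem_interior_decagon (by positivity) hx)
    · rintro y ⟨r, hr0, hr, hy⟩
      obtain ⟨a, ha, z, hz, hyz⟩ := decagon_step hval hr0 hy
      obtain ⟨b, hb, y', hy', hyz'⟩ := exists_lift_step (by norm_num) σ tau_mul_inv y ha hyz
      refine ⟨b, hb, y', ⟨_, ?_, ?_, hyz' ▸ hz⟩, hy'⟩
      · positivity
      · rw [sq]
        refine mul_lt_mul_of_pos_left (max_lt ?_ (by linarith)) (by linarith)
        linarith
    · rintro y ⟨r, hr0, hr, hy⟩ hsmall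
      refine mem_digitSpectrum_tau_of_small h hr0 hr hy ?_
      have h1 : 1 / (Real.goldenRatio - 1) = Real.goldenRatio := by
        rw [div_eq_iff (by linarith)]; linear_combination -hg
      rw [h1] at hsmall
      have : ‖(y : ℂ)‖ ≤ 1.6195 := by linarith
      nlinarith [norm_nonneg (y : ℂ)]

end Tau

/-! ### Expansions of given length and their remainders -/

section Expansions

variable {n : ℕ} {β x y : cyclotomicIntegers n}

/-- `x = a₀ + a₁ β + ⋯ + a_{k-1} β^{k-1} + β^k y` for some digits `a_i` in the alphabet. -/
def Expands (β : cyclotomicIntegers n) (x : cyclotomicIntegers n) : ℕ → cyclotomicIntegers n → Prop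
  | 0, y => x = y
  | k + 1, y => ∃ a : cyclotomicIntegers n, (a : ℂ) ∈ alphabet n ∧ Expands β x k (a + β * y)

theorem Expands.mem_digitSpectrum {k : ℕ} (h : Expands β x k y)
    (hy : (y : ℂ) ∈ digitSpectrum (alphabet n) β) : (x : ℂ) ∈ digitSpectrum (alphabet n) β := by
  induction k generalizing y with
  | zero => rw [show x = y from h]; exact hy
  | succ k ih =>
    obtain ⟨a, ha, h⟩ := h
    refine ih h ?_
    have := step_mem_digitSpectrum ha hy
    simpa using this

/-- The first k digits are kept; only the remainder moves. Perturbing x this way therefore yields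
new expansions of x itself. -/
theorem Expands.of_add {k : ℕ} {w : cyclotomicIntegers n} (h : Expands β (x + β ^ k * w) k y) :
    Expands β x k (y - w) := by
  induction k generalizing y w with
  | zero =>
    have h : x + β ^ 0 * w = y := h
    change x = y - w
    rw [← h]; ring
  | succ k ih =>
    obtain ⟨a, ha, h⟩ := h
    refine ⟨a, ha, ?_⟩
    rw [pow_succ, mul_assoc] at h
    have := ih h
    rwa [show a + β * (y - w) = a + β * y - β * w by ring]

theorem Expands.norm_sub_le (hn : n ≠ 0) {b : ℝ} (hβ : (β : ℂ) = b) (hb : 1 < b) {k : ℕ}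
    (h : Expands β x k y) : ‖(x : ℂ) - b ^ k * y‖ ≤ (b ^ k - 1) / (b - 1) := by
  have hb' : b - 1 ≠ 0 := by linarith
  induction k generalizing y with
  | zero => rw [show x = y from h]; simp
  | succ k ih =>
    obtain ⟨a, ha, h⟩ := h
    have h1 := ih h
    have e : (x : ℂ) - b ^ (k + 1) * y = (x - b ^ k * ((a + β * y : cyclotomicIntegers n) : ℂ))
        + b ^ k * a := by
      rw [AddMemClass.coe_add, MulMemClass.coe_mul, hβ]; ring
    rw [e]
    refine (norm_add_le _ _).trans ?_
    have h2 : ‖(b : ℂ) ^ k * a‖ ≤ b ^ k := by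
      rw [norm_mul, norm_pow, Complex.norm_real, Real.norm_of_nonneg (by linarith)]
      exact mul_le_of_le_one_right (by positivity) (norm_le_one_of_mem_alphabet hn ha)
    have h3 : (b ^ (k + 1) - 1) / (b - 1) = (b ^ k - 1) / (b - 1) + b ^ k := by
      field_simp; ring
    rw [h3]
    exact add_le_add h1 h2

/-- Strict because the digit sums are at most (b^k - 1)/(b - 1); the strictness is what later
excludes opposite remainders. -/
theorem Expands.norm_sub_lt (hn : n ≠ 0) {b : ℝ} (hβ : (β : ℂ) = b) (hb : 1 < b) {k : ℕ}
    {y' : cyclotomicIntegers n} (h : Expands β x k y) (h' : Expands β x k y') :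
    ‖(y : ℂ) - y'‖ < 2 / (b - 1) := by
  have h1 := h.norm_sub_le hn hβ hb
  have h2 := h'.norm_sub_le hn hβ hb
  have h3 := _root_.norm_sub_le ((x : ℂ) - b ^ k * y') ((x : ℂ) - b ^ k * y)
  have e : ((x : ℂ) - b ^ k * y') - ((x : ℂ) - b ^ k * y) = b ^ k * ((y : ℂ) - y') := by ring
  rw [e, norm_mul, norm_pow, Complex.norm_real, Real.norm_of_nonneg (by linarith)] at h3
  have hb0 : 0 < b - 1 := by linarith
  have hk : 0 < b ^ k := by positivity
  refine lt_of_mul_lt_mul_left ?_ hk.le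
  have h4 : (b ^ k - 1) / (b - 1) < b ^ k / (b - 1) := by gcongr; linarith
  have h5 : b ^ k * (2 / (b - 1)) = 2 * (b ^ k / (b - 1)) := by ring
  linarith

theorem exists_expands (hn : n ≠ 0) (σ : cyclotomicIntegers n ≃+* cyclotomicIntegers n)
    {β' : cyclotomicIntegers n} (hβ : β * β' = 1) (hγ : (σ β : ℂ) ≠ 0)
    (hx : (σ x : ℂ) ∈ attractor (σ β) (alphabet n)) (k : ℕ) :
    ∃ y, (σ y : ℂ) ∈ attractor (σ β) (alphabet n) ∧ Expands β x k y := by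
  induction k with
  | zero => exact ⟨x, hx, rfl⟩
  | succ k ih =>
    obtain ⟨y, hy, h⟩ := ih
    obtain ⟨a, ha, z, hz, hyz⟩ := exists_step_of_mem_attractor hγ hy
    obtain ⟨b, hb, y', rfl, hyz'⟩ := exists_lift_step hn σ hβ y ha hyz
    exact ⟨y', by rw [hyz']; exact hz, b, hb, h⟩

end Expansions

/-! ### Order 10 and β = τ²: small elements and the good disc -/

section TauSq

variable {σ : cyclotomicIntegers 10 ≃+* cyclotomicIntegers 10}

theorem norm_map_tau_lt_one (h : ‖(σ (tau ^ 2) : ℂ)‖ < 1) : ‖(σ tau : ℂ)‖ < 1 := by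
  rw [map_pow, SubmonoidClass.coe_pow, norm_pow] at h
  nlinarith [norm_nonneg (σ tau : ℂ)]

theorem coe_tau_sq : ((tau ^ 2 : cyclotomicIntegers 10) : ℂ) = (Real.goldenRatio ^ 2 : ℝ) := by
  rw [SubmonoidClass.coe_pow, coe_tau, Complex.ofReal_pow]

theorem map_tau_sq (h : ‖(σ tau : ℂ)‖ < 1) :
    (σ (tau ^ 2) : ℂ) = ((2 - Real.goldenRatio : ℝ) : ℂ) := by
  rw [map_pow, SubmonoidClass.coe_pow, map_tau_of_norm_lt_one h, ← Complex.ofReal_pow]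
  congr 1
  linear_combination Real.goldenRatio_sq

theorem norm_map_tau_sq (h : ‖(σ tau : ℂ)‖ < 1) :
    ‖(σ (tau ^ 2) : ℂ)‖ = 2 - Real.goldenRatio := by
  rw [map_tau_sq h, Complex.norm_real, Real.norm_of_nonneg]
  linarith [Real.goldenRatio_lt_two]

theorem tau_sq_mul_inv : tau ^ 2 * (tau - 1) ^ 2 = 1 := by
  rw [← mul_pow, tau_mul_inv, one_pow]

theorem map_tau_sq_ne_zero (σ : cyclotomicIntegers 10 ≃+* cyclotomicIntegers 10) :
    (σ (tau ^ 2) : ℂ) ≠ 0 := by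
  rw [map_pow, SubmonoidClass.coe_pow]
  exact pow_ne_zero 2 (map_tau_ne_zero σ)

/-- Take r = φ²/(2 cos(π/10)), for which both covering conditions are equalities and r² = (3φ +
2)/(φ + 2). -/
theorem exists_disc_radius : ∃ r : ℝ, 0 < r ∧ 1.894 < r ^ 2 ∧ r ^ 2 < 1.895 ∧
    1 ≤ 2 * ((2 - Real.goldenRatio) * r) * Real.cos (Real.pi / (10 : ℕ)) ∧
    r ^ 2 + 1 ≤ 2 * r * Real.cos (Real.pi / (10 : ℕ)) + ((2 - Real.goldenRatio) * r) ^ 2 := by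
  have hc := cos_pi_div_ten_pos
  have hc2 := cos_pi_div_ten_sq
  obtain ⟨g1, g2⟩ := goldenRatio_bounds
  have hg := Real.goldenRatio_sq
  generalize Real.cos (Real.pi / (10 : ℕ)) = c at *
  generalize Real.goldenRatio = g at *
  have hrc : 2 * (g ^ 2 / (2 * c)) * c = g ^ 2 := by field_simp
  have hr2 : (g ^ 2 / (2 * c)) ^ 2 * (2 + g) = 3 * g + 2 := by
    rw [← hc2]
    field_simp
    linear_combination 4 * (g ^ 2 + g + 2) * hg
  have hr : 0 < g ^ 2 / (2 * c) := by positivity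
  generalize g ^ 2 / (2 * c) = r at *
  refine ⟨r, hr, ?_, ?_, ?_, ?_⟩
  · nlinarith
  · nlinarith
  · have : 2 * ((2 - g) * r) * c = 1 := by linear_combination (2 - g) * hrc - (g - 1) * hg
    linarith
  · have : r ^ 2 + 1 = 2 * r * c + ((2 - g) * r) ^ 2 := by
      have h2 : 2 + g ≠ 0 := by linarith
      refine mul_left_cancel₀ h2 ?_
      rw [mul_pow, hrc]
      linear_combination (1 - (2 - g) ^ 2) * hr2 + (-4 * g + 4) * hg
    linarith

theorem map_eq_ev {x : cyclotomicIntegers 10} {c : Coords} (hx : (x : ℂ) = ev (gen 10) c) :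
    (σ x : ℂ) = ev (σ (gen 10)) c := by
  have h : x = (c.1 : cyclotomicIntegers 10) + c.2.1 * gen 10 + c.2.2.1 * gen 10 ^ 2
      + c.2.2.2 * gen 10 ^ 3 := by
    refine Subtype.ext (hx.trans ?_)
    simp [ev]
  rw [h]
  simp [ev]

/-- Elements that are small under both embeddings are `0` or of the form `ω^k / τ`. -/
theorem eq_zero_or_of_small (h : ‖(σ tau : ℂ)‖ < 1) {x : cyclotomicIntegers 10}
    (hx : ‖(x : ℂ)‖ ^ 2 < 0.4) (hσx : ‖(σ x : ℂ)‖ ^ 2 < 2.65) :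
    x = 0 ∨ ∃ k : Fin 10, (x : ℂ) = ev (gen 10) (rot^[k] tauInv) := by
  obtain ⟨c, hc, hσc⟩ := exists_ev σ x
  have htr : 2 * formP c + formQ c < 4 := by
    refine trace_lt_of_norm_sq_le h ?_
    rw [← hc, ← hσc]
    push_cast
    linarith
  obtain ⟨a0, a1, a2, a3, ha⟩ := exists_fin_coords (c := c) (m := 1) (by push_cast; linarith)
  have key := finite_check_tau_sq a0 a1 a2 a3
  simp only [Nat.cast_one] at ha
  rw [← ha] at key
  suffices H : _ ∧ _ by
    rcases key H.1 H.2 with h0 | ⟨k, hk⟩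
    · left
      refine Subtype.ext (hc.trans ?_)
      simp [h0, ev]
    · exact Or.inr ⟨k, by rw [hc, hk]⟩
  constructor
  · have := isNeg_of_lt_div (p := formP c) (q := formQ c) (m := 100) (b := 40) (by norm_num) (by
      rw [← norm_sq_coe_ev, ← hc]; push_cast; linarith)
    exact_mod_cast this
  · have := isNeg_of_lt_div (p := formP c + formQ c) (q := -formQ c) (m := 100) (b := 265)
      (by norm_num) (by
        have := norm_sq_map_ev h c
        rw [← hσc] at this
        push_cast
        linarith)
    rw [show -100 * formQ c = 100 * -formQ c by ring]
    exact_mod_cast this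

theorem norm_sq_rot (c : Coords) (k : ℕ) {θ : ℂ} {t : ℝ} (hθ : ‖θ‖ = 1)
    (ht : θ + conj θ = t) (ht2 : t ^ 2 = t + 1) :
    ‖ev θ (rot^[k] c)‖ ^ 2 = formP c + formQ c * t := by
  rw [ev_rot_iterate hθ ht ht2, norm_mul, norm_pow, hθ, one_pow, one_mul, norm_sq_ev hθ ht ht2]

theorem one_div_goldenRatio_sq_sub_one : 1 / (Real.goldenRatio ^ 2 - 1) = Real.goldenRatio - 1 := by
  rw [Real.goldenRatio_sq, add_sub_cancel_right,
    div_eq_iff (by linarith [Real.one_lt_goldenRatio])]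
  linear_combination -Real.goldenRatio_sq

/-- Descent inside the self-covering disc must end at 0: the other small elements ω^k/τ have
conjugates of modulus τ > r. -/
theorem mem_digitSpectrum_of_norm_le (h : ‖(σ tau : ℂ)‖ < 1) {r : ℝ} (hr : 0 < r)
    (hr2 : r ^ 2 < 1.895)
    (h1 : 1 ≤ 2 * ((2 - Real.goldenRatio) * r) * Real.cos (Real.pi / (10 : ℕ)))
    (h2 : r ^ 2 + 1 ≤ 2 * r * Real.cos (Real.pi / (10 : ℕ)) + ((2 - Real.goldenRatio) * r) ^ 2)
    {x : cyclotomicIntegers 10} (hx : ‖(σ x : ℂ)‖ ≤ r) :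
    (x : ℂ) ∈ digitSpectrum (alphabet 10) ((tau ^ 2 : cyclotomicIntegers 10) : ℂ) := by
  obtain ⟨g1, g2⟩ := goldenRatio_bounds
  have hn := norm_map_tau_sq h
  refine mem_digitSpectrum_of_descent (b := Real.goldenRatio ^ 2) (by norm_num) coe_tau_sq
    (by linarith [Real.goldenRatio_sq]) (S := {x | ‖(σ x : ℂ)‖ ≤ r}) ?_ (ε := 0.001)
    (by norm_num) ?_ hx
  · intro y hy
    obtain ⟨a, ha, z, hz, hyz⟩ := disc_step (n := 10) (by norm_num) (map_tau_sq_ne_zero σ)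
      (by rw [hn]; linarith) hr (by rwa [hn]) (by rwa [hn]) hy
    obtain ⟨b, hb, y', hy', hyz'⟩ := exists_lift_step (by norm_num) σ tau_sq_mul_inv y ha hyz
    exact ⟨b, hb, y', by rw [Set.mem_ofPred_eq, hyz']; exact hz, hy'⟩
  · intro y hy hsmall
    rw [one_div_goldenRatio_sq_sub_one] at hsmall
    have hy2 : ‖(σ y : ℂ)‖ ^ 2 < 1.895 :=
      (pow_le_pow_left₀ (norm_nonneg _) hy 2).trans_lt hr2
    rcases eq_zero_or_of_small h (x := y) (by
      have : ‖(y : ℂ)‖ ≤ 0.62 := by linarith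
      nlinarith [norm_nonneg (y : ℂ)]) (by linarith) with rfl | ⟨k, hk⟩
    · exact zero_mem_digitSpectrum (zero_mem_alphabet 10) _
    · exfalso
      rw [map_eq_ev hk, norm_sq_rot tauInv k (norm_map_gen_ten σ) (map_gen_ten_add_conj h)
        goldenConj_sq, show formP tauInv = 2 by decide, show formQ tauInv = -1 by decide] at hy2
      push_cast at hy2
      linarith

/-- To leave the disc of radius r, a must point well along z: Re(a z̄) > 0.66. As z and z' are
nearly opposite, the parallelogram law makes z + z' short, so a points along z - z' too. -/
theorem re_digit_pos {r g : ℝ} (hg1 : 0.381 < g) (hg2 : g < 0.382) (hr : 0 < r)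
    (hr2 : 1.894 < r ^ 2) {z z' a : ℂ} (hz : ‖z‖ ^ 2 < 2.6181) (hz' : ‖z'‖ ^ 2 < 2.6181)
    (he : 9.47 < ‖z - z'‖ ^ 2) (ha : a ∈ alphabet 10) (haz : r < ‖a + g * z‖) :
    a ^ 10 = 1 ∧ 0 < (a * conj (z - z')).re := by
  have h1 : r ^ 2 < ‖a + g * z‖ ^ 2 := pow_lt_pow_left₀ haz hr.le (by norm_num)
  have hgz : ‖(g : ℂ) * z‖ ^ 2 < 0.384 := by
    rw [norm_mul, mul_pow, Complex.norm_real, Real.norm_of_nonneg (by linarith)]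
    have : g ^ 2 < 0.146 := by nlinarith
    nlinarith [sq_nonneg ‖z‖]
  rcases (mem_alphabet_iff (by norm_num)).1 ha with rfl | ha
  · rw [zero_add] at h1
    linarith
  · refine ⟨ha, ?_⟩
    have hn := Complex.norm_eq_one_of_pow_eq_one ha (by norm_num)
    have h2 : ‖a + g * z‖ ^ 2 = 1 + ‖(g : ℂ) * z‖ ^ 2 + 2 * g * (a * conj z).re := by
      have := norm_sub_sq a (-(g * z))
      rw [sub_neg_eq_add, hn, norm_neg] at this
      rw [this]
      have e : a * conj (-(g * z)) = ((-g : ℝ) : ℂ) * (a * conj z) := by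
        rw [map_neg, map_mul, Complex.conj_ofReal]; push_cast; ring
      rw [e, Complex.re_ofReal_mul]; ring
    have h3 : 0.66 < (a * conj z).re := by nlinarith
    have h4 : ‖z + z'‖ ^ 2 < 1.0404 := by
      have := parallelogram_law_with_norm ℝ z z'
      nlinarith
    have h5 : ‖z + z'‖ < 1.02 := by
      refine lt_of_pow_lt_pow_left₀ 2 (by norm_num) ?_
      norm_num at h4 ⊢
      linarith
    have h6 : (a * conj (z + z')).re ≤ ‖z + z'‖ := by
      refine (Complex.re_le_norm _).trans ?_
      rw [norm_mul, hn, one_mul, RCLike.norm_conj]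
    have h7 : a * conj (z - z') = ((2 : ℝ) : ℂ) * (a * conj z) - a * conj (z + z') := by
      simp only [map_sub, map_add]; push_cast; ring
    rw [h7, Complex.sub_re, Complex.re_ofReal_mul]
    linarith

end TauSq

/-! ### Order 10 and β = τ²: remainders of an element outside the spectrum -/

section TauSq

variable {σ : cyclotomicIntegers 10 ≃+* cyclotomicIntegers 10}

theorem exists_rot_of_pow_eq_one {a : cyclotomicIntegers 10} (ha : (a : ℂ) ^ 10 = 1) :
    ∃ i : Fin 10, (a : ℂ) = ev (gen 10) (rot^[i] (1, 0, 0, 0)) := by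
  obtain ⟨i, hi⟩ := exists_pow_ten ha
  refine ⟨i, ?_⟩
  rw [ev_rot_iterate norm_gen_ten gen_ten_add_conj Real.goldenRatio_sq, ev_one, mul_one, ← hi]
  rfl

theorem ev_coe_mulTau_mulTau (c : Coords) :
    ev (gen 10) (mulTau (mulTau c)) = ((tau ^ 2 : cyclotomicIntegers 10) : ℂ) * ev (gen 10) c := by
  rw [ev_mulTau norm_gen_ten gen_ten_add_conj Real.goldenRatio_sq,
    ev_mulTau norm_gen_ten gen_ten_add_conj Real.goldenRatio_sq, coe_tau_sq]
  push_cast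
  ring

theorem norm_sub_lt_of_expands {k : ℕ} {x y y' : cyclotomicIntegers 10}
    (h : Expands (tau ^ 2) x k y) (h' : Expands (tau ^ 2) x k y') :
    ‖(y : ℂ) - y'‖ ^ 2 < 8 - 4 * Real.goldenRatio := by
  have hg := Real.one_lt_goldenRatio
  have h1 := h.norm_sub_lt (by norm_num) coe_tau_sq (by nlinarith) h'
  have h2 : 2 / (Real.goldenRatio ^ 2 - 1) = 2 * (Real.goldenRatio - 1) := by
    rw [← one_div_goldenRatio_sq_sub_one]; ring
  rw [h2] at h1
  have h3 := pow_lt_pow_left₀ h1 (norm_nonneg _) (n := 2) (by norm_num)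
  have h4 : (2 * (Real.goldenRatio - 1)) ^ 2 = 8 - 4 * Real.goldenRatio := by
    linear_combination 4 * Real.goldenRatio_sq
  rwa [h4] at h3

theorem isNeg_of_re_pos (h : ‖(σ tau : ℂ)‖ < 1) {c d : Coords}
    (hpos : 0 < (ev (σ (gen 10)) c * conj (ev (σ (gen 10)) d)).re) :
    isNeg (-(bilP c d + bilQ c d)) (bilQ c d) = true := by
  refine isNeg_of_lt ?_
  have := two_re_ev (norm_map_gen_ten σ) (map_gen_ten_add_conj h) goldenConj_sq c d
  change _ = (bilP c d : ℝ) + bilQ c d * (1 - Real.goldenRatio) at this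
  push_cast
  linarith

theorem isNeg_of_re_neg (h : ‖(σ tau : ℂ)‖ < 1) {c d : Coords}
    (hneg : (ev (σ (gen 10)) c * conj (ev (σ (gen 10)) d)).re < 0) :
    isNeg (bilP c d + bilQ c d) (-bilQ c d) = true := by
  refine isNeg_of_lt ?_
  have := two_re_ev (norm_map_gen_ten σ) (map_gen_ten_add_conj h) goldenConj_sq c d
  change _ = (bilP c d : ℝ) + bilQ c d * (1 - Real.goldenRatio) at this
  push_cast
  linarith

/-- If no element outside the spectrum has its conjugate in the disc of radius `r`, then two
expansions of an element outside the spectrum never end in remainders whose conjugates differ by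
the second longest diagonal of the decagon of radius `τ`. -/
theorem not_expands_of_diagonal (h : ‖(σ tau : ℂ)‖ < 1) {r : ℝ} (hr : 0 < r)
    (hr2 : 1.894 < r ^ 2)
    (hgood : ∀ x : cyclotomicIntegers 10, ‖(σ x : ℂ)‖ ≤ r →
      (x : ℂ) ∈ digitSpectrum (alphabet 10) ((tau ^ 2 : cyclotomicIntegers 10) : ℂ))
    {x : cyclotomicIntegers 10}
    (hx : (x : ℂ) ∉ digitSpectrum (alphabet 10) ((tau ^ 2 : cyclotomicIntegers 10) : ℂ)) (k : ℕ) :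
    ∀ y y' : cyclotomicIntegers 10, Expands (tau ^ 2) x k y → Expands (tau ^ 2) x k y' →
      ‖(σ y : ℂ)‖ ≤ Real.goldenRatio → ‖(σ y' : ℂ)‖ ≤ Real.goldenRatio →
      ∀ i : Fin 10, (y : ℂ) - y' ≠ ev (gen 10) (rot^[i] tauInvDiff) := by
  obtain ⟨g1, g2⟩ := goldenRatio_bounds
  have hg := Real.goldenRatio_sq
  have hP : formP tauInvDiff = 7 := by decide
  have hQ : formQ tauInvDiff = -4 := by decide
  induction k with
  | zero =>
    intro y y' hy hy' _ _ i hi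
    rw [show y = y' from (show x = y from hy).symm.trans hy', sub_self] at hi
    have := norm_sq_rot tauInvDiff i norm_gen_ten gen_ten_add_conj Real.goldenRatio_sq
    rw [← hi, hP, hQ] at this
    push_cast at this
    norm_num at this
    linarith
  | succ k ih =>
    rintro y y' ⟨a, ha, hy⟩ ⟨b, hb, hy'⟩ hyn hyn' i hi
    have hval := map_tau_sq h
    have coe_step : ∀ a y : cyclotomicIntegers 10, (σ (a + tau ^ 2 * y) : ℂ)
        = σ a + ((2 - Real.goldenRatio : ℝ) : ℂ) * σ y := by
      intro a y
      rw [map_add, map_mul, AddMemClass.coe_add, MulMemClass.coe_mul, hval]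
    have hstep : ∀ a y : cyclotomicIntegers 10, (a : ℂ) ∈ alphabet 10 →
        ‖(σ y : ℂ)‖ ≤ Real.goldenRatio → ‖(σ (a + tau ^ 2 * y) : ℂ)‖ ≤ Real.goldenRatio := by
      intro a y ha hy
      rw [coe_step]
      have h1 := norm_add_le (σ a : ℂ) (((2 - Real.goldenRatio : ℝ) : ℂ) * σ y)
      have h2 := norm_le_one_of_mem_alphabet (by norm_num) ((map_mem_alphabet_iff (by norm_num) σ a).2 ha)
      rw [norm_mul, Complex.norm_real, Real.norm_of_nonneg (by linarith)] at h1
      nlinarith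
    -- A remainder with conjugate in the good disc would put x in the spectrum.
    have hbad : ∀ y : cyclotomicIntegers 10, Expands (tau ^ 2) x k y → r < ‖(σ y : ℂ)‖ := by
      intro y hy
      by_contra hle
      exact hx (hy.mem_digitSpectrum (hgood y (not_lt.1 hle)))
    have hsq : ∀ z : ℂ, ‖z‖ ≤ Real.goldenRatio → ‖z‖ ^ 2 < 2.6181 := by
      intro z hz
      have := pow_le_pow_left₀ (norm_nonneg z) hz 2
      linarith
    have hdiff : (σ y : ℂ) - σ y' = ev (σ (gen 10)) (rot^[i] tauInvDiff) := by
      rw [← AddSubgroupClass.coe_sub, ← map_sub]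
      exact map_eq_ev (by rw [AddSubgroupClass.coe_sub]; exact hi)
    have hlen : 9.47 < ‖(σ y : ℂ) - σ y'‖ ^ 2 := by
      rw [hdiff, norm_sq_rot tauInvDiff i (norm_map_gen_ten σ) (map_gen_ten_add_conj h)
        goldenConj_sq, hP, hQ]
      push_cast
      linarith
    have ra := hbad _ hy
    have rb := hbad _ hy'
    rw [coe_step] at ra rb
    obtain ⟨a1, a2⟩ := re_digit_pos (by linarith) (by linarith) hr hr2 (hsq _ hyn) (hsq _ hyn')
      hlen ((map_mem_alphabet_iff (by norm_num) σ a).2 ha) ra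
    obtain ⟨b1, b2⟩ := re_digit_pos (by linarith) (by linarith) hr hr2 (hsq _ hyn') (hsq _ hyn)
      (by rwa [norm_sub_rev]) ((map_mem_alphabet_iff (by norm_num) σ b).2 hb) rb
    have pow_of : ∀ a : cyclotomicIntegers 10, (σ a : ℂ) ^ 10 = 1 → (a : ℂ) ^ 10 = 1 := by
      intro a ha
      have h1 : σ (a ^ 10) = σ 1 := Subtype.ext (by simpa using ha)
      simpa using congrArg (fun x : cyclotomicIntegers 10 => (x : ℂ)) (σ.injective h1)
    obtain ⟨p, hp⟩ := exists_rot_of_pow_eq_one (pow_of a a1)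
    obtain ⟨q, hq⟩ := exists_rot_of_pow_eq_one (pow_of b b1)
    have hd : ((a + tau ^ 2 * y : cyclotomicIntegers 10) : ℂ)
        - ((b + tau ^ 2 * y' : cyclotomicIntegers 10) : ℂ)
        = ev (gen 10) (add (sub (rot^[p] (1, 0, 0, 0)) (rot^[q] (1, 0, 0, 0)))
          (mulTau (mulTau (rot^[i] tauInvDiff)))) := by
      rw [ev_add, ev_sub, ev_coe_mulTau_mulTau, ← hp, ← hq, ← hi]
      simp only [AddMemClass.coe_add, MulMemClass.coe_mul]
      ring
    -- The preceding remainders differ by such a diagonal again, so the configuration propagates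
    -- back to depth 0, where both remainders equal x.
    obtain ⟨j, hj⟩ := finite_check_diff i p q
      (isNeg_of_re_pos h (by rwa [← map_eq_ev hp, ← hdiff]))
      (isNeg_of_re_neg h (by
        rw [← map_eq_ev hq, ← hdiff, ← neg_sub, map_neg, mul_neg, Complex.neg_re]
        linarith))
      (isNeg_of_lt (by
        have := norm_sub_lt_of_expands hy hy'
        rw [hd, norm_sq_coe_ev] at this
        push_cast
        linarith))
    exact ih _ _ hy hy' (hstep a y ha hyn) (hstep b y' hb hyn') j (by rw [hd, hj])

theorem mem_digitSpectrum_of_mem_interior (h : ‖(σ (tau ^ 2) : ℂ)‖ < 1)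
    {x : cyclotomicIntegers 10}
    (hx : (σ x : ℂ) ∈ interior (attractor (σ (tau ^ 2)) (alphabet 10))) :
    (x : ℂ) ∈ digitSpectrum (alphabet 10) ((tau ^ 2 : cyclotomicIntegers 10) : ℂ) := by
  have h' := norm_map_tau_lt_one h
  obtain ⟨g1, g2⟩ := goldenRatio_bounds
  have hg := Real.goldenRatio_sq
  obtain ⟨r, hr, hrl, hru, hr1, hr2⟩ := exists_disc_radius
  have hgood : ∀ x : cyclotomicIntegers 10, ‖(σ x : ℂ)‖ ≤ r →
      (x : ℂ) ∈ digitSpectrum (alphabet 10) ((tau ^ 2 : cyclotomicIntegers 10) : ℂ) :=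
    fun x hx => mem_digitSpectrum_of_norm_le h' hr hru hr1 hr2 hx
  by_contra hbad
  have hval := map_tau_sq h'
  set γ : ℂ := ((σ (tau ^ 2) : cyclotomicIntegers 10) : ℂ) with hγ
  -- The shift w = β^m ω^i has |σ(w)| = |γ|^m, small enough that (φ + |σ(w)|)² < 2.65.
  obtain ⟨m, hm⟩ := exists_pow_lt_of_lt_one (show (0 : ℝ) < 0.005 by norm_num)
    (show 2 - Real.goldenRatio < 1 by linarith)
  have hlim : ∀ i : Fin 10, ∀ᶠ k : ℕ in Filter.atTop,
      (σ x : ℂ) + γ ^ k * (γ ^ m * (σ (gen 10) : ℂ) ^ (i : ℕ)) ∈ attractor γ (alphabet 10) := by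
    intro i
    have h1 := (tendsto_pow_atTop_nhds_zero_of_norm_lt_one h).mul_const
      (γ ^ m * (σ (gen 10) : ℂ) ^ (i : ℕ))
    have h2 := h1.const_add (σ x : ℂ)
    rw [zero_mul, add_zero] at h2
    exact h2.eventually (mem_interior_iff_mem_nhds.1 hx)
  have hsmall : ∀ᶠ k : ℕ in Filter.atTop, ‖(x : ℂ)‖ / 0.001 < (Real.goldenRatio ^ 2) ^ k :=
    (tendsto_pow_atTop_atTop_of_one_lt (by linarith)).eventually_gt_atTop _
  -- One depth k serves all ten directions, so that the remainders found are comparable; it also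
  -- makes |x|/β^k negligible.
  obtain ⟨k, hk, hkx⟩ := ((Filter.eventually_all.2 hlim).and hsmall).exists
  have hrem : ∀ s : cyclotomicIntegers 10, Expands (tau ^ 2) x k s → ‖(s : ℂ)‖ ^ 2 < 0.4 := by
    intro s hs
    have h1 := hs.norm_sub_le (by norm_num) coe_tau_sq (by linarith)
    rw [div_eq_mul_one_div, one_div_goldenRatio_sq_sub_one] at h1
    have hpos : 0 < (Real.goldenRatio ^ 2) ^ k := by positivity
    have h2 := norm_sub_norm_le (((Real.goldenRatio ^ 2 : ℝ) : ℂ) ^ k * s) (x : ℂ)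
    rw [norm_sub_rev, norm_mul, norm_pow, Complex.norm_real, Real.norm_of_nonneg (by positivity)]
      at h2
    rw [div_lt_iff₀ (by norm_num)] at hkx
    generalize (Real.goldenRatio ^ 2) ^ k = B at *
    have h3 : ‖(s : ℂ)‖ < 0.62 := by
      refine lt_of_mul_lt_mul_left ?_ hpos.le
      nlinarith
    nlinarith [norm_nonneg (s : ℂ)]
  have hvertex : ∀ j : Fin 10, ‖ev (σ (gen 10)) (rot^[j] tauInv)‖ ^ 2 = Real.goldenRatio ^ 2 := by
    intro j
    rw [norm_sq_rot tauInv j (norm_map_gen_ten σ) (map_gen_ten_add_conj h') goldenConj_sq,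
      show formP tauInv = 2 by decide, show formQ tauInv = -1 by decide]
    push_cast
    linarith
  refine false_of_directions (V := fun j => ∃ u : cyclotomicIntegers 10,
    (u : ℂ) = ev (gen 10) (rot^[j] tauInv) ∧ Expands (tau ^ 2) x k u) ?_ ?_
  · rintro i j ⟨u, hu, hux⟩ ⟨v, hv, hvx⟩ hij
    have huv : (u : ℂ) - v = ev (gen 10) (sub (rot^[i] tauInv) (rot^[j] tauInv)) := by
      rw [ev_sub, hu, hv]
    have hdiag : j - i = 2 ∨ j - i = 8 → False := by
      intro hij
      obtain ⟨l, hl⟩ := sub_tauInv i j hij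
      have hle : ∀ (j : Fin 10) (u : cyclotomicIntegers 10),
          (u : ℂ) = ev (gen 10) (rot^[j] tauInv) → ‖(σ u : ℂ)‖ ≤ Real.goldenRatio := by
        intro j u hu
        refine le_of_sq_le_sq ?_ (by linarith)
        rw [map_eq_ev hu, hvertex]
      exact not_expands_of_diagonal h' hr hrl hgood hbad k u v hux hvx (hle i u hu) (hle j v hv) l
        (by rw [huv, hl])
    rcases hij with hij | hij | hij
    · exact hdiag (Or.inl hij)
    · have h1 := norm_sub_lt_of_expands hux hvx
      obtain ⟨hP, hQ⟩ := sub_tauInv_opposite i j hij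
      rw [huv, norm_sq_coe_ev, hP, hQ] at h1
      push_cast at h1
      linarith
    · exact hdiag (Or.inr hij)
  · intro i
    set w : cyclotomicIntegers 10 := (tau ^ 2) ^ m * gen 10 ^ (i : ℕ) with hw
    have hσw : (σ w : ℂ) = γ ^ m * (σ (gen 10) : ℂ) ^ (i : ℕ) := by
      rw [hw, map_mul, map_pow σ (tau ^ 2) m, map_pow σ (gen 10), MulMemClass.coe_mul,
        SubmonoidClass.coe_pow, SubmonoidClass.coe_pow]
    have hmem : (σ (x + (tau ^ 2) ^ k * w) : ℂ) ∈ attractor γ (alphabet 10) := by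
      have := hk i
      rw [← hσw] at this
      rw [map_add, map_mul, map_pow, AddMemClass.coe_add, MulMemClass.coe_mul,
        SubmonoidClass.coe_pow]
      exact this
    obtain ⟨t, ht, hxt⟩ := exists_expands (by norm_num) σ tau_sq_mul_inv (map_tau_sq_ne_zero σ)
      hmem k
    have hs := hxt.of_add
    have htn := norm_le_of_mem_attractor
      (fun _ => norm_le_one_of_mem_alphabet (n := 10) (by norm_num)) h ht
    have hb : 1 / (1 - ‖γ‖) = Real.goldenRatio := by
      rw [hγ, norm_map_tau_sq h', div_eq_iff (by linarith)]
      linear_combination -hg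
    rw [hb] at htn
    have hγn : ‖γ ^ m‖ = (2 - Real.goldenRatio) ^ m := by rw [norm_pow, hγ, norm_map_tau_sq h']
    have hθ := norm_map_gen_ten σ
    have hwn : ‖(σ w : ℂ)‖ = (2 - Real.goldenRatio) ^ m := by
      rw [hσw, norm_mul, hγn, norm_pow, hθ, one_pow, mul_one]
    have hσs : (σ (t - w) : ℂ) = σ t - σ w := by rw [map_sub, AddSubgroupClass.coe_sub]
    have hsn : ‖(σ (t - w) : ℂ)‖ ^ 2 < 2.65 := by
      have h1 := norm_sub_le (σ t : ℂ) (σ w)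
      rw [← hσs, hwn] at h1
      have h2 : ‖(σ (t - w) : ℂ)‖ ≤ 1.6232 := by linarith
      nlinarith [norm_nonneg (σ (t - w) : ℂ)]
    rcases eq_zero_or_of_small h' (hrem _ hs) hsn with h0 | ⟨j, hj⟩
    · exfalso
      refine hbad (hs.mem_digitSpectrum ?_)
      rw [h0]
      exact zero_mem_digitSpectrum (zero_mem_alphabet 10) _
    · refine ⟨j, ⟨t - w, hj, hs⟩, finite_check_direction i j (isNeg_of_re_neg h' ?_)⟩
      have hj' := map_eq_ev (σ := σ) hj
      -- The vertex σ(t - w) has modulus φ, yet adding σ(w) ≠ 0 gives σ(t) ∈ K of modulus at most φ;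
      -- their inner product is thus negative.
      have h1 : ‖(σ (t - w) : ℂ) - -(σ w)‖ ^ 2 ≤ Real.goldenRatio ^ 2 := by
        refine pow_le_pow_left₀ (norm_nonneg _) ?_ 2
        rw [hσs, sub_neg_eq_add, sub_add_cancel]
        exact htn
      have hpos : 0 < (2 - Real.goldenRatio) ^ m := by
        have : 0 < 2 - Real.goldenRatio := by linarith
        positivity
      rw [norm_sub_sq, hj', hvertex, norm_neg, hwn] at h1
      have e1 : ev (σ (gen 10)) (rot^[i] (1, 0, 0, 0)) = (σ (gen 10) : ℂ) ^ (i : ℕ) := by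
        rw [ev_rot_iterate hθ (map_gen_ten_add_conj h') goldenConj_sq, ev_one, mul_one]
      have e2 : ev (σ (gen 10)) (rot^[j] tauInv) * conj (-(σ w : ℂ))
          = ((-(2 - Real.goldenRatio) ^ m : ℝ) : ℂ) * (ev (σ (gen 10)) (rot^[j] tauInv)
            * conj (ev (σ (gen 10)) (rot^[i] (1, 0, 0, 0)))) := by
        rw [hσw, hval, e1, map_neg, map_mul, ← Complex.ofReal_pow, Complex.conj_ofReal,
          Complex.ofReal_neg]
        ring
      rw [e2, Complex.re_ofReal_mul] at h1
      generalize (2 - Real.goldenRatio) ^ m = G at *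
      nlinarith

theorem tau_sq_part (h : ‖(σ (tau ^ 2) : ℂ)‖ < 1) :
    IsWindow (interior (attractor (σ (tau ^ 2)) (alphabet 10))) ∧
      digitSpectrum (alphabet 10) ((tau ^ 2 : cyclotomicIntegers 10) : ℂ) =
        cutProject σ (interior (attractor (σ (tau ^ 2)) (alphabet 10))) := by
  have h' := norm_map_tau_lt_one h
  obtain ⟨r, hr, -, -, hr1, hr2⟩ := exists_disc_radius
  have hn := norm_map_tau_sq h'
  have h0 : (0 : ℂ) ∈ interior (attractor (σ (tau ^ 2)) (alphabet 10)) :=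
    zero_mem_interior_attractor (by norm_num) (map_tau_sq_ne_zero σ) h hr (by rwa [hn])
      (by rwa [hn])
  have hτ : tau ^ 2 ≠ 0 := by intro ht; apply map_tau_sq_ne_zero σ; rw [ht]; simp
  refine ⟨(isWindow_attractor (by norm_num) h h0).1, subset_antisymm ?_ ?_⟩
  · exact digitSpectrum_subset_cutProject (by norm_num) σ hτ h0
  · rintro _ ⟨x, rfl, hx⟩
    exact mem_digitSpectrum_of_mem_interior h hx

end TauSq

end PisotCyclotomic

theorem mainTheorem10 :
    -- order 8, `β = δ`
    ((∃ σ : cyclotomicIntegers 8 ≃+* cyclotomicIntegers 8, ‖(σ delta : ℂ)‖ < 1) ∧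
      ∀ σ : cyclotomicIntegers 8 ≃+* cyclotomicIntegers 8, ‖(σ delta : ℂ)‖ < 1 →
        IsWindow (interior (attractor (σ delta) (alphabet 8))) ∧
        IsWindow (attractor (σ delta) (alphabet 8)) ∧
        digitSpectrum (alphabet 8) delta =
          cutProject σ (interior (attractor (σ delta) (alphabet 8))) ∧
        digitSpectrum (alphabet 8) delta =
          cutProject σ (attractor (σ delta) (alphabet 8))) ∧
    -- order 10, `β = τ`
    ((∃ σ : cyclotomicIntegers 10 ≃+* cyclotomicIntegers 10, ‖(σ tau : ℂ)‖ < 1) ∧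
      ∀ σ : cyclotomicIntegers 10 ≃+* cyclotomicIntegers 10, ‖(σ tau : ℂ)‖ < 1 →
        IsWindow (openPolygon 10 (Real.goldenRatio ^ 2)) ∧
        interior (attractor (σ tau) (alphabet 10)) = openPolygon 10 (Real.goldenRatio ^ 2) ∧
        digitSpectrum (alphabet 10) tau =
          cutProject σ (openPolygon 10 (Real.goldenRatio ^ 2))) ∧
    -- order 10, `β = τ²`
    ((∃ σ : cyclotomicIntegers 10 ≃+* cyclotomicIntegers 10, ‖(σ (tau ^ 2) : ℂ)‖ < 1) ∧
      ∀ σ : cyclotomicIntegers 10 ≃+* cyclotomicIntegers 10, ‖(σ (tau ^ 2) : ℂ)‖ < 1 →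
        IsWindow (interior (attractor (σ (tau ^ 2)) (alphabet 10))) ∧
        digitSpectrum (alphabet 10) ((tau ^ 2 : cyclotomicIntegers 10) : ℂ) =
          cutProject σ (interior (attractor (σ (tau ^ 2)) (alphabet 10)))) := by
  refine ⟨⟨exists_automorphism_delta, eight_part⟩,
    ⟨exists_automorphism_tau, fun _ => tau_part⟩, ?_, fun _ => tau_sq_part⟩
  obtain ⟨σ, hσ⟩ := exists_automorphism_tau
  refine ⟨σ, ?_⟩
  rw [map_pow, SubmonoidClass.coe_pow, norm_pow]
  exact pow_lt_one₀ (norm_nonneg _) hσ (by norm_num)
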